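/- Assume the Diamond Principle $\Diamond$ in the following form: there is a sequence $\langle f_\alpha\in(2^\alpha)^\omega\colon \omega\le\alpha<\omega_1\rangle$ such that for every $f\in(2^{\omega_1})^\omega$ the set $\{\alpha\in[\omega,\omega_1)\colon f(n)\restriction\alpha=f_\alpha(n)\text{ for all }n\in\omega\}$ is stationary in $\omega_1$. Then there exists an infinite Boolean algebra $\mathcal{A}$ such that: 1. $\mathcal{A}$ is minimally generated, i.e. there are an ordinal $\delta$ and an increasing sequence $\langle\mathcal{A}_\alpha\colon\alpha\le\delta\rangle$ of subalgebras of $\mathcal{A}$ such that $\mathcal{A}_\delta=\mathcal{A}$; $\mathcal{A}_0$ is isomorphic to the free Boolean algebra $Fr(\omega)$ on countably infinitely many generators; $\mathcal{A}_\gamma=\bigcup_{\alpha<\gamma}\mathcal{A}_\alpha$ for every limit $\gamma\le\delta$; and for every $\alpha<\delta$ there is no subalgebra $\mathcal{C}$ with $\mathcal{A}_\alpha\subsetneq\mathcal{C}\subsetneq\mathcal{A}_{\alpha+1}$. 2. $\mathcal{A}$ has the Nikodym property, i.e. for every sequence $(\mu_n)_{n\in\omega}$ of bounded finitely additive signed real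 measures on $\mathcal{A}$ with $\sup_n|\mu_n(A)|<\infty$ for each $A\in\mathcal{A}$, we have $\sup_n\|\mu_n\|<\infty$, where $\|\mu\|=\sup\{|\mu(A)|+|\mu(B)|\colon A,B\in\mathcal{A},\ A\wedge B=0\}$. 3. Every non-atomic Radon probability measure $\mu$ on the Stone space $St(\mathcal{A})$ (the space of ultrafilters on $\mathcal{A}$) is uniformly regular, i.e. there is a countable family $\mathcal{C}$ of zero sets (sets $\{f=0\}$ with $f\in C(St(\mathcal{A}),\mathbb{R})$) such that for every open $U\subseteq St(\mathcal{A})$ and every $\varepsilon>0$ there is $F\in\mathcal{C}$ with $F\subseteq U$ and $\mu(U\setminus F)<\varepsilon$. 4. In particular, every non-atomic Radon probability measure $\mu$ on $St(\mathcal{A})$ admits a $\mu$-uniformly distributed sequence, i.e. a sequence $(x_n)_{n\in\omega}$ in $St(\mathcal{A})$ such that $\frac1n\sum_{i=0}^{n-1}\delta_{x_i}$ converges weakly* to $\mu$. -/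

import Mathlib

open scoped Ordinal ENNReal Topology

/-- The diamond principle `◊` on `ω₁`: there are guesses `F α ∈ (2^α)^ω` such that every
`f ∈ (2^{ω₁})^ω` is guessed correctly at stationarily many `α ∈ [ω, ω₁)`.
(The values of `F` below `ω` play no role.) -/
def DiamondPrinciple : Prop :=
  ∃ F : (α : Set.Iio (ω₁ : Ordinal.{0})) → ℕ → Set.Iio α → Bool,
    ∀ f : ℕ → Set.Iio (ω₁ : Ordinal.{0}) → Bool,
      IsStationary {α : Set.Iio (ω₁ : Ordinal.{0}) |
        ω ≤ (α : Ordinal.{0}) ∧ ∀ (n : ℕ) (β : Set.Iio α), f n β = F α n β}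

namespace BooleanAlg

universe u

section Algebra

variable (A : Type u) [BooleanAlgebra A]

/-- `A` is (isomorphic to) the free Boolean algebra `Fr(ω)` on countably many generators. -/
def IsFreeOnCountable : Prop :=
  ∃ g : ℕ → A, ∀ (C : Type u) [BooleanAlgebra C] (f : ℕ → C),
    ∃! φ : BoundedLatticeHom A C, ∀ n, φ (g n) = f n

/-- For subalgebras `S ≤ T` of an ambient algebra: `T` is a minimal extension of `S`. -/
def IsMinimalExtension {A : Type u} [BooleanAlgebra A] (S T : BooleanSubalgebra A) : Prop :=
  S ≤ T ∧ ¬ ∃ C : BooleanSubalgebra A, S < C ∧ C < T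

/-- `A` is minimally generated: it is the last term of a continuous increasing chain
`(S α)_{α ≤ δ}` of subalgebras starting from a copy of `Fr(ω)`, with minimal extensions at
successor steps. (The values `S α` for `α > δ` play no role.) -/
def IsMinimallyGenerated : Prop :=
  ∃ (δ : Ordinal.{u}) (S : Ordinal.{u} → BooleanSubalgebra A),
    MonotoneOn S (Set.Iic δ) ∧
    S δ = ⊤ ∧
    IsFreeOnCountable (S 0) ∧
    (∀ γ ≤ δ, Order.IsSuccLimit γ → (S γ : Set A) = ⋃ α ∈ Set.Iio γ, (S α : Set A)) ∧
    ∀ α < δ, IsMinimalExtension (S α) (S (Order.succ α))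

/-- Bounded finitely additive signed measures on a Boolean algebra. -/
structure FinAddMeasure where
  toFun : A → ℝ
  map_sup' : ∀ a b, Disjoint a b → toFun (a ⊔ b) = toFun a + toFun b
  bounded' : BddAbove {r : ℝ | ∃ a b, Disjoint a b ∧ r = |toFun a| + |toFun b|}

/-- The norm `‖μ‖ = sup {|μ a| + |μ b| : a ∧ b = 0}`. -/
noncomputable def FinAddMeasure.norm {A : Type u} [BooleanAlgebra A] (μ : FinAddMeasure A) : ℝ :=
  sSup {r : ℝ | ∃ a b, Disjoint a b ∧ r = |μ.toFun a| + |μ.toFun b|}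

/-- The Nikodym property: every pointwise bounded sequence of measures is uniformly bounded. -/
def HasNikodymProperty : Prop :=
  ∀ μ : ℕ → FinAddMeasure A,
    (∀ a : A, BddAbove (Set.range fun n => |(μ n).toFun a|)) →
      BddAbove (Set.range fun n => (μ n).norm)

/-- Ultrafilters on a Boolean algebra. -/
structure IsUltrafilterOn {A : Type u} [BooleanAlgebra A] (U : Set A) : Prop where
  top_mem : ⊤ ∈ U
  bot_notMem : ⊥ ∉ U
  inf_mem : ∀ ⦃a b⦄, a ∈ U → b ∈ U → a ⊓ b ∈ U
  mem_of_le : ∀ ⦃a b⦄, a ∈ U → a ≤ b → b ∈ U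
  mem_or_compl_mem : ∀ a, a ∈ U ∨ aᶜ ∈ U

/-- The Stone space `St(A)`: the set of all ultrafilters on `A`. -/
def StoneSpace : Type u := {U : Set A // IsUltrafilterOn U}

/-- The Stone topology, with base the sets `{U | a ∈ U}` for `a ∈ A`. -/
instance : TopologicalSpace (StoneSpace A) :=
  TopologicalSpace.generateFrom (Set.range fun a : A => {U : StoneSpace A | a ∈ U.1})

instance : MeasurableSpace (StoneSpace A) := borel _

instance : BorelSpace (StoneSpace A) := ⟨rfl⟩

end Algebra

section Measure

open MeasureTheory

/-- `μ` is non-atomic: every measurable set of positive measure has a measurable subset of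
strictly smaller positive measure. -/
def IsNonAtomic {K : Type u} [MeasurableSpace K] (μ : Measure K) : Prop :=
  ∀ B, MeasurableSet B → 0 < μ B → ∃ C, MeasurableSet C ∧ C ⊆ B ∧ 0 < μ C ∧ μ C < μ B

/-- Zero sets: sets of zeros of continuous real-valued functions. -/
def IsZeroSet {K : Type u} [TopologicalSpace K] (F : Set K) : Prop := ∃ f : C(K, ℝ), F = {x | f x = 0}

/-- Uniformly regular measures. -/
def IsUniformlyRegular {K : Type u} [TopologicalSpace K] [MeasurableSpace K]
    (μ : Measure K) : Prop :=
  ∃ 𝒞 : Set (Set K), 𝒞.Countable ∧ (∀ F ∈ 𝒞, IsZeroSet F) ∧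
    ∀ U : Set K, IsOpen U → ∀ ε : ℝ≥0∞, 0 < ε → ∃ F ∈ 𝒞, F ⊆ U ∧ μ (U \ F) < ε

/-- `x` is `μ`-uniformly distributed: `(1/n) ∑_{i<n} δ_{x i}` converges weakly* to `μ`, that is,
after integration against every continuous real-valued function. -/
def IsUniformlyDistributed {K : Type u} [TopologicalSpace K] [MeasurableSpace K]
    (μ : Measure K) (x : ℕ → K) : Prop :=
  ∀ f : C(K, ℝ), Filter.Tendsto
    (fun n : ℕ => ∫ y, f y ∂((n : ℝ≥0∞)⁻¹ • ∑ i ∈ Finset.range n, Measure.dirac (x i)))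
    Filter.atTop (𝓝 (∫ y, f y ∂μ))

end Measure

end BooleanAlg

open Filter

/-! ### Finitely additive measures on algebras of sets, and one step of a gliding hump. -/

namespace SetAlgebra

variable {X : Type*} {𝒜 ℬ : BooleanSubalgebra (Set X)} {a b e u : Set X}

/-! The algebra is an increasing union of ω₁ countable algebras of subsets of the Cantor space,
starting with the one generated by the cylinders. Each successor adjoins one set `v` that either is
already present or splits a single ultrafilter: for a decreasing base `U j` of it, every `v \ U j`
is already present. Such extensions are minimal (`Admissible.isMinimalExtension`).

Nikodym property. On a countable algebra, a gliding hump turns a pointwise bounded, not uniformly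
bounded sequence `m` into such a `v` (`IsAntiNikodym.exists_kills`): no extension of `m` which
leaves the mass at the split ultrafilter entirely on one side of `v`, the same side for all `n`, is
bounded at `v`. Diamond guesses such sequences, and the recursion kills each guess
(`exists_generators`). If the final algebra had a bad sequence, take a positive measure controlling
all its terms. For each ε this measure is two-valued up to ε on the pieces of a finite cover, and
all these covers appear at some countable stage. After that stage no splitting can divide the mass
at an ultrafilter, so a correct guess at a later limit stage is contradicted by the set adjoined
there (`isNikodym_of_generators`).

Uniform regularity. A non-atomic Radon measure vanishes at points, so by compactness there are
finite covers by sets of arbitrarily small measure, again all present at a countable stage. Later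
splittings occur inside arbitrarily small sets, so that stage approximates every later element from
below (`exists_stage_subset`), and its clopen sets are the required zero sets. By the strong law of
large numbers a random sequence has the right frequencies on these countably many sets, which
implies weak* convergence. -/

theorem union_mem (ha : a ∈ 𝒜) (hb : b ∈ 𝒜) : a ∪ b ∈ 𝒜 := BooleanSubalgebra.sup_mem ha hb

theorem inter_mem (ha : a ∈ 𝒜) (hb : b ∈ 𝒜) : a ∩ b ∈ 𝒜 := BooleanSubalgebra.inf_mem ha hb

theorem diff_mem (ha : a ∈ 𝒜) (hb : b ∈ 𝒜) : a \ b ∈ 𝒜 := BooleanSubalgebra.sdiff_mem ha hb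

theorem empty_mem : (∅ : Set X) ∈ 𝒜 := BooleanSubalgebra.bot_mem

theorem univ_mem : (Set.univ : Set X) ∈ 𝒜 := BooleanSubalgebra.top_mem

/-- `m` restricts to a bounded finitely additive signed measure on the algebra of sets `𝒜`. -/
structure IsFinAdd (𝒜 : BooleanSubalgebra (Set X)) (m : Set X → ℝ) : Prop where
  add : ∀ a ∈ 𝒜, ∀ b ∈ 𝒜, Disjoint a b → m (a ∪ b) = m a + m b
  bdd : ∃ B, ∀ a ∈ 𝒜, |m a| ≤ B

namespace IsFinAdd

variable {m ν : Set X → ℝ}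

theorem mono (h : IsFinAdd ℬ m) (hle : 𝒜 ≤ ℬ) : IsFinAdd 𝒜 m :=
  ⟨fun a ha b hb => h.add a (hle ha) b (hle hb), h.bdd.imp fun _ hB a ha => hB a (hle ha)⟩

theorem empty (h : IsFinAdd 𝒜 m) : m ∅ = 0 := by
  have := h.add ∅ empty_mem ∅ empty_mem (by simp)
  simp at this
  exact this

theorem inter_add_diff (h : IsFinAdd 𝒜 m) (ha : a ∈ 𝒜) (he : e ∈ 𝒜) :
    m (a ∩ e) + m (a \ e) = m a := by
  rw [← h.add _ (inter_mem ha he) _ (diff_mem ha he) (Set.disjoint_sdiff_inter.symm),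
    Set.inter_union_sdiff]

theorem diff (h : IsFinAdd 𝒜 m) (ha : a ∈ 𝒜) (hb : b ∈ 𝒜) (hab : a ⊆ b) :
    m (b \ a) = m b - m a := by
  have := h.inter_add_diff hb ha
  rw [Set.inter_eq_right.2 hab] at this
  linarith

theorem mono_of_nonneg (h : IsFinAdd 𝒜 ν) (h0 : ∀ a ∈ 𝒜, 0 ≤ ν a) (ha : a ∈ 𝒜) (hb : b ∈ 𝒜)
    (hab : a ⊆ b) : ν a ≤ ν b := by
  have := h.diff ha hb hab
  have := h0 _ (diff_mem hb ha)
  linarith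

/-- A bounded finitely additive measure is dominated by a positive one. -/
theorem exists_majorant (h : IsFinAdd 𝒜 m) :
    ∃ ν, IsFinAdd 𝒜 ν ∧ ∀ a ∈ 𝒜, |m a| ≤ ν a := by
  obtain ⟨B, hB⟩ := h.bdd
  set T : Set X → Set ℝ := fun a => {r | ∃ b ∈ 𝒜, b ⊆ a ∧ r = m b} with hT
  have hbd : ∀ a, BddAbove (T a) := fun a => ⟨B, by
    rintro _ ⟨b, hb, -, rfl⟩; exact (abs_le.1 (hB b hb)).2⟩
  have hne : ∀ a, (T a).Nonempty := fun a => ⟨m ∅, ∅, empty_mem, by simp, rfl⟩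
  have hle : ∀ a b, b ∈ 𝒜 → b ⊆ a → m b ≤ sSup (T a) := fun a b hb hba =>
    le_csSup (hbd a) ⟨b, hb, hba, rfl⟩
  have hadd : ∀ a ∈ 𝒜, ∀ b ∈ 𝒜, Disjoint a b → sSup (T (a ∪ b)) = sSup (T a) + sSup (T b) := by
    intro a ha b hb hab
    apply le_antisymm
    · refine csSup_le (hne _) ?_
      rintro _ ⟨c, hc, hcab, rfl⟩
      rw [← h.inter_add_diff hc ha]
      refine add_le_add (hle _ _ (inter_mem hc ha) Set.inter_subset_right)
        (hle _ _ (diff_mem hc ha) ?_)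
      intro y hy
      exact (hcab hy.1).resolve_left hy.2
    · rw [← le_sub_iff_add_le]
      refine csSup_le (hne _) ?_
      rintro _ ⟨c, hc, hca, rfl⟩
      rw [le_sub_comm]
      refine csSup_le (hne _) ?_
      rintro _ ⟨d, hd, hdb, rfl⟩
      rw [le_sub_iff_add_le', ← h.add c hc d hd (hab.mono hca hdb)]
      exact hle _ _ (union_mem hc hd) (Set.union_subset_union hca hdb)
  have h0 : ∀ a, 0 ≤ sSup (T a) := fun a => by
    rw [← h.empty]; exact hle a ∅ empty_mem (by simp)
  -- The supremum is the positive part of `m`, so this is m⁺ + m⁻, the total variation.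
  refine ⟨fun a => 2 * sSup (T a) - m a, ⟨fun a ha b hb hab => ?_, 3 * B, fun a ha => ?_⟩,
    fun a ha => ?_⟩
  · simp only [hadd a ha b hb hab, h.add a ha b hb hab]; ring
  · have h1 := h0 a
    have h2 : sSup (T a) ≤ B := csSup_le (hne _) (by
      rintro _ ⟨b, hb, -, rfl⟩; exact (abs_le.1 (hB b hb)).2)
    have h3 := abs_le.1 (hB a ha)
    have h4 := hle a a ha subset_rfl
    rw [abs_le]; constructor <;> linarith
  · have h1 := h0 a
    have h4 := hle a a ha subset_rfl
    rw [abs_le]; constructor <;> linarith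

end IsFinAdd

/-- `U` generates an ultrafilter of `𝒜`. -/
structure Shrinks (𝒜 : BooleanSubalgebra (Set X)) (U : ℕ → Set X) : Prop where
  anti : Antitone U
  mem : ∀ j, U j ∈ 𝒜
  nonempty : ∀ j, (U j).Nonempty
  decides : ∀ e ∈ 𝒜, ∃ j, U j ⊆ e ∨ Disjoint (U j) e

/-- A sequence of measures on `𝒜` which is pointwise bounded but not uniformly bounded. -/
structure IsAntiNikodym (𝒜 : BooleanSubalgebra (Set X)) (m : ℕ → Set X → ℝ) : Prop where
  finAdd : ∀ n, IsFinAdd 𝒜 (m n)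
  pointwise : ∀ a ∈ 𝒜, ∃ C, ∀ n, |m n a| ≤ C
  unbounded : ∀ C, ∃ n, ∃ a ∈ 𝒜, C < |m n a|

/-- `v` witnesses that every extension of `m` which does not split the point of the Stone space
generated by `U` fails to be pointwise bounded. -/
def Kills (𝒜 : BooleanSubalgebra (Set X)) (m : ℕ → Set X → ℝ) (v : Set X) : Prop :=
  ∃ U, Shrinks 𝒜 U ∧ (∀ j, v \ U j ∈ 𝒜) ∧
    ∀ (ℬ : BooleanSubalgebra (Set X)) (m' : ℕ → Set X → ℝ), 𝒜 ≤ ℬ → v ∈ ℬ →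
      (∀ n, IsFinAdd ℬ (m' n)) → (∀ n, ∀ a ∈ 𝒜, m' n a = m n a) →
      ((∀ n, Tendsto (fun j => m' n (v ∩ U j)) atTop (𝓝 0)) ∨
        (∀ n, Tendsto (fun j => m' n (U j \ v)) atTop (𝓝 0))) →
      ¬ ∃ C, ∀ n, |m' n v| ≤ C

/-- The sequence `m` is not uniformly bounded below `u`. -/
def UnboundedBelow (𝒜 : BooleanSubalgebra (Set X)) (m : ℕ → Set X → ℝ) (u : Set X) : Prop :=
  ∀ C, ∃ n, ∃ a ∈ 𝒜, a ⊆ u ∧ C < |m n a|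

theorem UnboundedBelow.nonempty {m : ℕ → Set X → ℝ} (hm : ∀ n, IsFinAdd 𝒜 (m n))
    (h : UnboundedBelow 𝒜 m u) : u.Nonempty := by
  obtain ⟨n, a, -, hau, hC⟩ := h 0
  by_contra hu
  rw [Set.not_nonempty_iff_eq_empty] at hu
  subst hu
  rw [Set.subset_empty_iff.1 hau, (hm n).empty] at hC
  simp at hC

/-- If both halves had bounds, their sum would bound `m` below `u`. Unboundedness can thus be
pursued along an ultrafilter. -/
theorem UnboundedBelow.split {m : ℕ → Set X → ℝ} (hm : ∀ n, IsFinAdd 𝒜 (m n))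
    (h : UnboundedBelow 𝒜 m u) (he : e ∈ 𝒜) :
    UnboundedBelow 𝒜 m (u ∩ e) ∨ UnboundedBelow 𝒜 m (u \ e) := by
  by_contra! hcon
  simp only [UnboundedBelow, not_forall, not_exists, not_and, not_lt] at hcon
  obtain ⟨⟨C, hC⟩, D, hD⟩ := hcon
  obtain ⟨n, a, ha, hau, hlt⟩ := h (C + D)
  have h1 := hC n (a ∩ e) (inter_mem ha he) (Set.inter_subset_inter_left _ hau)
  have h2 := hD n (a \ e) (diff_mem ha he) (Set.sdiff_subset_sdiff_left hau)
  have h3 := (hm n).inter_add_diff ha he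
  have := abs_add_le (m n (a ∩ e)) (m n (a \ e))
  rw [h3] at this
  linarith

/-- One step of the construction of a set killing an anti-Nikodym sequence. -/
theorem IsAntiNikodym.exists_step {m : ℕ → Set X → ℝ} (hm : IsAntiNikodym 𝒜 m)
    {ν : ℕ → Set X → ℝ} (hν : ∀ n, ∀ a ∈ 𝒜, |m n a| ≤ ν n a)
    (hu : u ∈ 𝒜) (hub : UnboundedBelow 𝒜 m u) (he : e ∈ 𝒜) (K : ℝ) :
    ∃ n, ∃ a ∈ 𝒜, ∃ w ∈ 𝒜, a ⊆ u ∧ K < |m n a| ∧ w ⊆ u ∧ Disjoint a w ∧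
      UnboundedBelow 𝒜 m w ∧ (w ⊆ e ∨ Disjoint w e) ∧
      ∀ z ∈ 𝒜, z ⊆ w → UnboundedBelow 𝒜 m z → ν n w ≤ ν n z + 1 := by
  obtain ⟨n, a, ha, w, hw, hau, hK, hwu, haw, hwub⟩ : ∃ n, ∃ a ∈ 𝒜, ∃ w ∈ 𝒜,
      a ⊆ u ∧ K < |m n a| ∧ w ⊆ u ∧ Disjoint a w ∧ UnboundedBelow 𝒜 m w := by
    obtain ⟨C, hC⟩ := hm.pointwise u hu
    -- Since `C` bounds `m n u`, exceeding `K + C` on `a` forces more than `K` on `u \ a` too.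
    -- Either piece can serve as the hump, so the other is chosen to be one on which `m` stays
    -- unbounded.
    obtain ⟨n, a, ha, hau, hlt⟩ := hub (max K 0 + C)
    have h1 := (hm.finAdd n).diff ha hu hau
    have h2 := hC n
    have h0 := (abs_nonneg _).trans h2
    have hK := le_max_left K 0
    rcases hub.split hm.finAdd ha with h | h
    · refine ⟨n, u \ a, diff_mem hu ha, u ∩ a, inter_mem hu ha, Set.sdiff_subset, ?_,
        Set.inter_subset_left, Set.disjoint_sdiff_inter, h⟩
      have := abs_sub_abs_le_abs_sub (m n a) (m n u)
      rw [h1, abs_sub_comm]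
      linarith
    · exact ⟨n, a, ha, u \ a, diff_mem hu ha, hau, by linarith, Set.sdiff_subset,
        Set.disjoint_sdiff_right, h⟩
  obtain ⟨w', hw', hw'w, hw'ub, hdec⟩ : ∃ w' ∈ 𝒜, w' ⊆ w ∧ UnboundedBelow 𝒜 m w' ∧
      (w' ⊆ e ∨ Disjoint w' e) := by
    rcases hwub.split hm.finAdd he with h | h
    · exact ⟨_, inter_mem hw he, Set.inter_subset_left, h, Or.inl Set.inter_subset_right⟩
    · exact ⟨_, diff_mem hw he, Set.sdiff_subset, h, Or.inr Set.disjoint_sdiff_left⟩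
  -- Nearly minimizing `ν n` among the unbounded subsets ensures that later shrinking to unbounded
  -- sets discards at most 1 of the variation of `m n`.
  set T : Set ℝ := {r | ∃ z ∈ 𝒜, z ⊆ w' ∧ UnboundedBelow 𝒜 m z ∧ r = ν n z}
  have hT : BddBelow T := ⟨0, by
    rintro _ ⟨z, hz, -, -, rfl⟩; exact (abs_nonneg _).trans (hν n z hz)⟩
  obtain ⟨_, ⟨w₂, hw₂, hsub, hub₂, rfl⟩, hlt⟩ :=
    exists_lt_of_csInf_lt (s := T) ⟨_, w', hw', subset_rfl, hw'ub, rfl⟩ (lt_add_one (sInf T))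
  refine ⟨n, a, ha, w₂, hw₂, hau, hK, (hsub.trans hw'w).trans hwu, haw.mono_right
    (hsub.trans hw'w), hub₂, hdec.imp hsub.trans (fun h => h.mono_left hsub), fun z hz hzw hzub => ?_⟩
  have : sInf T ≤ ν n z := csInf_le hT ⟨z, hz, hzw.trans hsub, hzub, rfl⟩
  linarith

/-- The values of a measure along the sets `y \ U j` converge. -/
theorem IsFinAdd.exists_tendsto_diff {m : Set X → ℝ} (hm : IsFinAdd 𝒜 m) {U : ℕ → Set X}
    (hU : Antitone U) (hU𝒜 : ∀ j, U j ∈ 𝒜) {y : Set X} (hy : ∀ j, y \ U j ∈ 𝒜) :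
    ∃ l, Tendsto (fun j => m (y \ U j)) atTop (𝓝 l) := by
  obtain ⟨ν, hν, hmν⟩ := hm.exists_majorant
  have hν0 : ∀ a ∈ 𝒜, 0 ≤ ν a := fun a ha => (abs_nonneg _).trans (hmν a ha)
  have hanti : Antitone fun j => ν (U j) := fun i j hij =>
    hν.mono_of_nonneg hν0 (hU𝒜 j) (hU𝒜 i) (hU hij)
  have hc : CauchySeq fun j => ν (U j) :=
    (tendsto_atTop_ciInf hanti ⟨0, by rintro _ ⟨j, rfl⟩; exact hν0 _ (hU𝒜 j)⟩).cauchySeq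
  -- The increment of `y \ U j` lies in `U i \ U j`, so the convergent sequence `ν (U j)` controls
  -- it.
  have key : ∀ i j, i ≤ j → |m (y \ U j) - m (y \ U i)| ≤ |ν (U j) - ν (U i)| := by
    intro i j hij
    have hsub : y \ U i ⊆ y \ U j := Set.sdiff_subset_sdiff_right (hU hij)
    rw [← hm.diff (hy i) (hy j) hsub]
    refine (hmν _ (diff_mem (hy j) (hy i))).trans ?_
    rw [abs_sub_comm]
    refine le_trans ?_ (le_abs_self _)
    rw [← hν.diff (hU𝒜 j) (hU𝒜 i) (hU hij)]
    refine hν.mono_of_nonneg hν0 (diff_mem (hy j) (hy i)) (diff_mem (hU𝒜 i) (hU𝒜 j)) ?_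
    rintro z ⟨⟨hzy, hzj⟩, hz⟩
    exact ⟨by_contra fun h => hz ⟨hzy, h⟩, hzj⟩
  apply cauchySeq_tendsto_of_complete
  rw [Metric.cauchySeq_iff'] at hc ⊢
  intro ε hε
  obtain ⟨N, hN⟩ := hc ε hε
  exact ⟨N, fun n hn => (key N n hn).trans_lt (hN n hn)⟩

end SetAlgebra

/-! ### The gliding hump: a set killing an anti-Nikodym sequence. -/

namespace SetAlgebra

variable {X : Type*} {𝒜 ℬ : BooleanSubalgebra (Set X)} {a b e u : Set X}

/-- Data produced by iterating `IsAntiNikodym.exists_step`. -/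
structure KillingSystem (𝒜 : BooleanSubalgebra (Set X)) (m ν : ℕ → Set X → ℝ) where
  U : ℕ → Set X
  A : ℕ → Set X
  D : ℕ → ℝ
  N : ℕ → ℕ
  U_zero : U 0 = Set.univ
  D_zero : D 0 = 0
  U_mem : ∀ k, U k ∈ 𝒜
  A_mem : ∀ k, A k ∈ 𝒜
  A_subset : ∀ k, A k ⊆ U k
  lt_abs : ∀ k, D k + k + 1 < |m (N k) (A k)|
  U_anti : Antitone U
  disj : ∀ k, Disjoint (A k) (U (k + 1))
  U_nonempty : ∀ k, (U k).Nonempty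
  decides : ∀ e ∈ 𝒜, ∃ k, U k ⊆ e ∨ Disjoint (U k) e
  small : ∀ k j, k + 1 ≤ j → ν (N k) (U (k + 1)) ≤ ν (N k) (U j) + 1
  D_succ : ∀ k n, |m n (A k)| + D k ≤ D (k + 1)

/-- Deciding the `k`-th member of the countable algebra at step `k` makes the `U k` an ultrafilter
base. Pointwise boundedness on each hump gives a number `D k` dominating the sum of the earlier
humps for all `n` at once. -/
theorem IsAntiNikodym.exists_killingSystem {m : ℕ → Set X → ℝ} (hm : IsAntiNikodym 𝒜 m)
    {ν : ℕ → Set X → ℝ} (hν : ∀ n, ∀ a ∈ 𝒜, |m n a| ≤ ν n a) (hc : (𝒜 : Set (Set X)).Countable) :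
    Nonempty (KillingSystem 𝒜 m ν) := by
  obtain ⟨e, he⟩ := hc.exists_eq_range ⟨∅, empty_mem⟩
  have heA : ∀ k, e k ∈ 𝒜 := fun k => by
    rw [← SetLike.mem_coe, he]; exact ⟨k, rfl⟩
  have step : ∀ (k : ℕ) (p : {u // u ∈ 𝒜 ∧ UnboundedBelow 𝒜 m u} × ℝ),
      ∃ (q : {u // u ∈ 𝒜 ∧ UnboundedBelow 𝒜 m u} × ℝ) (n : ℕ) (a : Set X), a ∈ 𝒜 ∧
        a ⊆ p.1.1 ∧ p.2 + k + 1 < |m n a| ∧ q.1.1 ⊆ p.1.1 ∧ Disjoint a q.1.1 ∧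
        (q.1.1 ⊆ e k ∨ Disjoint q.1.1 (e k)) ∧
        (∀ z ∈ 𝒜, z ⊆ q.1.1 → UnboundedBelow 𝒜 m z → ν n q.1.1 ≤ ν n z + 1) ∧
        ∀ n', |m n' a| + p.2 ≤ q.2 := by
    rintro k ⟨⟨u, hu, hub⟩, D⟩
    obtain ⟨n, a, ha, w, hw, hau, hK, hwu, haw, hwub, hdec, hmin⟩ :=
      hm.exists_step hν hu hub (heA k) (D + k + 1)
    obtain ⟨C, hC⟩ := hm.pointwise a ha
    exact ⟨⟨⟨w, hw, hwub⟩, C + D⟩, n, a, ha, hau, hK, hwu, haw, hdec, hmin,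
      fun n' => add_le_add_left (hC n') D⟩
  choose q n a ha hau hK hqu haq hdec hmin hD using step
  have h0 : UnboundedBelow 𝒜 m Set.univ := fun C => by
    obtain ⟨n, a, ha, h⟩ := hm.unbounded C
    exact ⟨n, a, ha, Set.subset_univ _, h⟩
  let s : ℕ → {u // u ∈ 𝒜 ∧ UnboundedBelow 𝒜 m u} × ℝ := fun k =>
    Nat.rec ⟨⟨Set.univ, univ_mem, h0⟩, 0⟩ (fun k p => q k p) k
  have hs : ∀ k, s (k + 1) = q k (s k) := fun k => rfl
  have hanti : Antitone fun k => (s k).1.1 := antitone_nat_of_succ_le fun k => by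
    rw [hs]; exact hqu k (s k)
  refine ⟨⟨fun k => (s k).1.1, fun k => a k (s k), fun k => (s k).2, fun k => n k (s k), rfl, rfl,
    fun k => (s k).1.2.1, fun k => ha k _, fun k => hau k _, fun k => hK k _, hanti,
    fun k => haq k _, fun k => (s k).1.2.2.nonempty hm.finAdd, fun f hf => ?_, fun k j hkj => ?_,
    fun k n' => hD k _ n'⟩⟩
  · rw [← SetLike.mem_coe, he] at hf
    obtain ⟨k, rfl⟩ := hf
    exact ⟨k + 1, hdec k (s k)⟩
  · exact hmin k (s k) _ (s j).1.2.1 (hanti hkj) (s j).1.2.2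

namespace KillingSystem

variable {m ν : ℕ → Set X → ℝ} (K : KillingSystem 𝒜 m ν) (M : Set ℕ)

/-- The union of the sets `A k` for `k ∈ M`. -/
def V : Set X := ⋃ k ∈ M, K.A k

theorem notMem_U_of_mem_A {y : X} {k j : ℕ} (hy : y ∈ K.A k) (h : k < j) : y ∉ K.U j := fun hj =>
  Set.disjoint_left.1 (K.disj k) hy (K.U_anti h hj)

theorem V_diff_succ_of_mem {j : ℕ} (hj : j ∈ M) :
    K.V M \ K.U (j + 1) = (K.V M \ K.U j) ∪ K.A j := by
  ext y
  simp only [V, Set.mem_sdiff, Set.mem_iUnion, Set.mem_union]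
  constructor
  · rintro ⟨⟨k, hk, hy⟩, hyU⟩
    rcases lt_trichotomy k j with h | rfl | h
    · exact Or.inl ⟨⟨k, hk, hy⟩, K.notMem_U_of_mem_A hy h⟩
    · exact Or.inr hy
    · exact absurd (K.U_anti h (K.A_subset k hy)) hyU
  · rintro (⟨h, hyU⟩ | hy)
    · exact ⟨h, fun h => hyU (K.U_anti j.le_succ h)⟩
    · exact ⟨⟨j, hj, hy⟩, K.notMem_U_of_mem_A hy j.lt_succ_self⟩

theorem V_diff_succ_of_notMem {j : ℕ} (hj : j ∉ M) :
    K.V M \ K.U (j + 1) = K.V M \ K.U j := by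
  ext y
  simp only [V, Set.mem_sdiff, Set.mem_iUnion]
  constructor
  · rintro ⟨⟨k, hk, hy⟩, hyU⟩
    rcases lt_trichotomy k j with h | rfl | h
    · exact ⟨⟨k, hk, hy⟩, K.notMem_U_of_mem_A hy h⟩
    · exact absurd hk hj
    · exact absurd (K.U_anti h (K.A_subset k hy)) hyU
  · rintro ⟨h, hyU⟩
    exact ⟨h, fun h => hyU (K.U_anti j.le_succ h)⟩

theorem V_diff_mem (j : ℕ) : K.V M \ K.U j ∈ 𝒜 := by
  induction j with
  | zero => rw [K.U_zero]; simpa using! empty_mem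
  | succ j ih =>
    by_cases hj : j ∈ M
    · rw [K.V_diff_succ_of_mem M hj]; exact union_mem ih (K.A_mem j)
    · rwa [K.V_diff_succ_of_notMem M hj]

theorem disjoint_V_diff_A (j : ℕ) : Disjoint (K.V M \ K.U j) (K.A j) :=
  Set.disjoint_sdiff_left.mono_right (K.A_subset j)

theorem abs_V_diff_le (hm : ∀ n, IsFinAdd 𝒜 (m n)) (n j : ℕ) : |m n (K.V M \ K.U j)| ≤ K.D j := by
  induction j with
  | zero => rw [K.U_zero, K.D_zero]; simp [(hm n).empty]
  | succ j ih =>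
    have hD := K.D_succ j n
    by_cases hj : j ∈ M
    · rw [K.V_diff_succ_of_mem M hj,
        (hm n).add _ (K.V_diff_mem M j) _ (K.A_mem j) (K.disjoint_V_diff_A M j)]
      have := abs_add_le (m n (K.V M \ K.U j)) (m n (K.A j))
      linarith
    · rw [K.V_diff_succ_of_notMem M hj]
      have := abs_nonneg (m n (K.A j))
      linarith

/-- The head before `k` contributes at most `D k`, the hump `A k` more than `D k + k + 1`, and the
tail, lying in `U (k + 1) \ U j`, at most 1. -/
theorem le_abs_V_diff (hm : ∀ n, IsFinAdd 𝒜 (m n)) (hν : ∀ n, IsFinAdd 𝒜 (ν n))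
    (hmν : ∀ n, ∀ a ∈ 𝒜, |m n a| ≤ ν n a) {k j : ℕ} (hk : k ∈ M) (hkj : k + 1 ≤ j) :
    (k : ℝ) ≤ |m (K.N k) (K.V M \ K.U j)| := by
  set n := K.N k
  have hsub : K.V M \ K.U (k + 1) ⊆ K.V M \ K.U j :=
    Set.sdiff_subset_sdiff_right (K.U_anti hkj)
  have h1 := (hm n).diff (K.V_diff_mem M (k + 1)) (K.V_diff_mem M j) hsub
  have h2 : |m n ((K.V M \ K.U j) \ (K.V M \ K.U (k + 1)))| ≤ 1 := by
    refine (hmν n _ (diff_mem (K.V_diff_mem M j) (K.V_diff_mem M _))).trans ?_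
    have h3 := (hν n).diff (K.U_mem j) (K.U_mem (k + 1)) (K.U_anti hkj)
    have h4 := K.small k j hkj
    have h5 : ν n ((K.V M \ K.U j) \ (K.V M \ K.U (k + 1))) ≤ ν n (K.U (k + 1) \ K.U j) := by
      refine (hν n).mono_of_nonneg (fun a ha => (abs_nonneg _).trans (hmν n a ha))
        (diff_mem (K.V_diff_mem M j) (K.V_diff_mem M _)) (diff_mem (K.U_mem _) (K.U_mem _)) ?_
      rintro z ⟨⟨hzy, hzj⟩, hz⟩
      exact ⟨by_contra fun h => hz ⟨hzy, h⟩, hzj⟩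
    linarith
  rw [h1, K.V_diff_succ_of_mem M hk, (hm n).add _ (K.V_diff_mem M k) _ (K.A_mem k)
    (K.disjoint_V_diff_A M k)] at h2
  have h6 := K.abs_V_diff_le M hm n k
  have h7 := K.lt_abs k
  rw [abs_le] at h2 h6
  rcases _root_.lt_abs.1 h7 with h | h
  · refine le_trans ?_ (le_abs_self _); linarith
  · refine le_trans ?_ (neg_le_abs _); linarith

end KillingSystem

/-- The limit `L M n` of `m n` on `V M \ U j` is the part of `V M` away from the split ultrafilter,
and `c n` is the mass at it. A one-sided extension has value `L M n` or `L M n + c n` at `V M`, so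
both must be unbounded in `n` for a suitable `M`. -/
theorem IsAntiNikodym.exists_kills {m : ℕ → Set X → ℝ} (hm : IsAntiNikodym 𝒜 m)
    (hc : (𝒜 : Set (Set X)).Countable) : ∃ v, Kills 𝒜 m v := by
  choose ν hν hmν using fun n => (hm.finAdd n).exists_majorant
  obtain ⟨K⟩ := hm.exists_killingSystem hmν hc
  choose L hL using fun (M : Set ℕ) n =>
    (hm.finAdd n).exists_tendsto_diff K.U_anti K.U_mem (K.V_diff_mem M)
  choose c' hc' using fun n => (hm.finAdd n).exists_tendsto_diff K.U_anti K.U_mem (y := Set.univ)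
    (fun j => diff_mem univ_mem (K.U_mem j))
  set c : ℕ → ℝ := fun n => m n Set.univ - c' n with hcdef
  have hU : ∀ n, Tendsto (fun j => m n (K.U j)) atTop (𝓝 (c n)) := by
    intro n
    refine ((hc' n).const_sub (m n Set.univ)).congr fun j => ?_
    rw [(hm.finAdd n).diff (K.U_mem j) univ_mem (Set.subset_univ _)]; ring
  have hLk : ∀ (M : Set ℕ), ∀ k ∈ M, (k : ℝ) ≤ |L M (K.N k)| := fun M k hk =>
    ge_of_tendsto (hL M (K.N k)).abs ((eventually_ge_atTop (k + 1)).mono fun j hj =>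
      K.le_abs_V_diff M hm.finAdd hν hmν hk hj)
  have hLub : ∀ M : Set ℕ, M.Infinite → ¬ ∃ C, ∀ n, |L M n| ≤ C := by
    rintro M hM ⟨C, hC⟩
    obtain ⟨k, hk, hlt⟩ := hM.exists_gt ⌈C⌉₊
    have := (hLk M k hk).trans (hC _)
    have h2 : C ≤ ⌈C⌉₊ := Nat.le_ceil C
    have h3 : (⌈C⌉₊ : ℝ) < k := by exact_mod_cast hlt
    linarith
  have hadd : ∀ n, L Set.univ n = L {k | Even k} n + L {k | ¬ Even k} n := by
    intro n
    refine tendsto_nhds_unique (hL _ n) (((hL _ n).add (hL _ n)).congr fun j => ?_)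
    rw [← (hm.finAdd n).add _ (K.V_diff_mem _ j) _ (K.V_diff_mem _ j)]
    · rw [← Set.union_sdiff_distrib]
      congr 2
      simp only [KillingSystem.V, Set.mem_univ, Set.iUnion_true, Set.mem_ofPred_eq]
      ext y
      simp only [Set.mem_union, Set.mem_iUnion]
      constructor
      · rintro (⟨k, -, h⟩ | ⟨k, -, h⟩) <;> exact ⟨k, h⟩
      · rintro ⟨k, h⟩
        by_cases hk : Even k
        · exact Or.inl ⟨k, hk, h⟩
        · exact Or.inr ⟨k, hk, h⟩
    · refine Disjoint.mono Set.sdiff_subset Set.sdiff_subset (Set.disjoint_left.2 ?_)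
      intro y h1 h2
      simp only [KillingSystem.V, Set.mem_iUnion, Set.mem_ofPred_eq] at h1 h2
      obtain ⟨k, hk, hyk⟩ := h1
      obtain ⟨i, hi, hyi⟩ := h2
      rcases lt_trichotomy k i with h | rfl | h
      · exact K.notMem_U_of_mem_A hyk h (K.A_subset _ hyi)
      · exact hi hk
      · exact K.notMem_U_of_mem_A hyi h (K.A_subset _ hyk)
  have hodd : ({k | ¬ Even k} : Set ℕ).Infinite := by
    refine Set.infinite_of_forall_exists_gt fun n => ⟨2 * n + 1, ?_, by omega⟩
    simp
  have heven : ({k | Even k} : Set ℕ).Infinite := by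
    refine Set.infinite_of_forall_exists_gt fun n => ⟨2 * n + 2, ?_, by omega⟩
    exact ⟨n + 1, by ring⟩
  -- Adding `c` might cancel the growth of `L M`, but not for all `M`: were it bounded for both ℕ
  -- and the even numbers, subtracting would bound `L` on the odd numbers.
  obtain ⟨M, hM, hMc⟩ : ∃ M : Set ℕ, M.Infinite ∧ ¬ ∃ C, ∀ n, |L M n + c n| ≤ C := by
    by_contra! hcon
    obtain ⟨C₁, h₁⟩ := hcon Set.univ Set.infinite_univ
    obtain ⟨C₂, h₂⟩ := hcon _ heven
    refine hLub _ hodd ⟨C₁ + C₂, fun n => ?_⟩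
    have e1 : L {k | ¬ Even k} n = (L Set.univ n + c n) - (L {k | Even k} n + c n) := by
      rw [hadd]; ring
    rw [e1]
    exact (abs_sub _ _).trans (add_le_add (h₁ n) (h₂ n))
  refine ⟨K.V M, K.U, ⟨K.U_anti, K.U_mem, K.U_nonempty, K.decides⟩, K.V_diff_mem M, ?_⟩
  rintro ℬ m' hle hv hm' hag (h | h) ⟨C, hC⟩
  · refine hLub M hM ⟨C, fun n => ?_⟩
    convert hC n using 2
    refine tendsto_nhds_unique (hL M n) ?_
    have h1 := (h n).const_sub (m' n (K.V M))
    rw [sub_zero] at h1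
    refine h1.congr fun j => ?_
    rw [← hag n _ (K.V_diff_mem M j), ← (hm' n).inter_add_diff hv (hle (K.U_mem j))]
    ring
  · refine hMc ⟨C, fun n => ?_⟩
    convert hC n using 2
    refine tendsto_nhds_unique ((hL M n).add (hU n)) ?_
    have h1 := (h n).const_add (m' n (K.V M))
    rw [add_zero] at h1
    refine h1.congr fun j => ?_
    rw [← hag n _ (K.V_diff_mem M j), ← hag n _ (K.U_mem j),
      ← (hm' n).inter_add_diff hv (hle (K.U_mem j)),
      ← (hm' n).inter_add_diff (hle (K.U_mem j)) hv, Set.inter_comm]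
    ring

end SetAlgebra

/-! ### Generated subalgebras and minimal extensions by one set. -/

theorem BooleanSubalgebra.countable_closure {α : Type*} [BooleanAlgebra α] {s : Set α}
    (hs : s.Countable) : (BooleanSubalgebra.closure s : Set α).Countable := by
  let T : ℕ → Set α := fun n => Nat.rec (insert ⊥ s)
    (fun _ t => t ∪ (compl '' t ∪ Set.image2 (· ⊔ ·) t t)) n
  have hT : ∀ n, T (n + 1) = T n ∪ (compl '' T n ∪ Set.image2 (· ⊔ ·) (T n) (T n)) :=
    fun n => rfl
  have hcount : ∀ n, (T n).Countable := by
    intro n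
    induction n with
    | zero => exact hs.insert ⊥
    | succ n ih => rw [hT]; exact ih.union ((ih.image _).union (ih.image2 ih _))
  have hmono : Monotone T := monotone_nat_of_le_succ fun n => by
    rw [hT]; exact Set.subset_union_left
  refine (Set.countable_iUnion hcount).mono fun x hx => ?_
  induction hx using closure_bot_sup_induction with
  | mem x hx => exact Set.mem_iUnion.2 ⟨0, Or.inr hx⟩
  | bot => exact Set.mem_iUnion.2 ⟨0, Or.inl rfl⟩
  | sup x _ y _ hx hy =>
    obtain ⟨i, hi⟩ := Set.mem_iUnion.1 hx
    obtain ⟨j, hj⟩ := Set.mem_iUnion.1 hy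
    refine Set.mem_iUnion.2 ⟨max i j + 1, ?_⟩
    rw [hT]
    exact Or.inr (Or.inr ⟨x, hmono (le_max_left i j) hi, y, hmono (le_max_right i j) hj, rfl⟩)
  | compl x _ hx =>
    obtain ⟨i, hi⟩ := Set.mem_iUnion.1 hx
    refine Set.mem_iUnion.2 ⟨i + 1, ?_⟩
    rw [hT]
    exact Or.inr (Or.inl ⟨x, hi, rfl⟩)

/-- Restricting a minimal extension to a larger subalgebra, viewed as an algebra of its own. -/
theorem BooleanAlg.IsMinimalExtension.comap_subtype {α : Type*} [BooleanAlgebra α]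
    {S T W : BooleanSubalgebra α} (h : BooleanAlg.IsMinimalExtension S T) (hT : T ≤ W) :
    BooleanAlg.IsMinimalExtension (S.comap W.subtype) (T.comap W.subtype) := by
  refine ⟨BooleanSubalgebra.comap_mono h.1, ?_⟩
  rintro ⟨C, hSC, hCT⟩
  refine h.2 ⟨C.map W.subtype, ?_, ?_⟩
  · rw [SetLike.lt_iff_le_and_exists] at hSC ⊢
    obtain ⟨hle, y, hyC, hyS⟩ := hSC
    exact ⟨fun z hz => ⟨⟨z, hT (h.1 hz)⟩, hle hz, rfl⟩, y, ⟨y, hyC, rfl⟩, hyS⟩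
  · rw [SetLike.lt_iff_le_and_exists] at hCT ⊢
    obtain ⟨hle, y, hyT, hyC⟩ := hCT
    refine ⟨?_, y, hyT, ?_⟩
    · rintro _ ⟨z, hz, rfl⟩; exact hle hz
    · rintro ⟨z, hz, hzy⟩
      exact hyC (by rwa [← Subtype.ext hzy])

namespace SetAlgebra

section

variable {X : Type*} {𝒜 ℬ : BooleanSubalgebra (Set X)} {a b e u v : Set X} {U : ℕ → Set X}

/-- The subalgebra generated by `𝒜` and `v`. -/
def adjoin (𝒜 : BooleanSubalgebra (Set X)) (v : Set X) : BooleanSubalgebra (Set X) :=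
  BooleanSubalgebra.closure (insert v 𝒜)

theorem le_adjoin : 𝒜 ≤ adjoin 𝒜 v := fun _ h =>
  BooleanSubalgebra.subset_closure (Set.mem_insert_of_mem _ h)

theorem mem_adjoin_self : v ∈ adjoin 𝒜 v :=
  BooleanSubalgebra.subset_closure (Set.mem_insert _ _)

theorem exists_of_mem_adjoin (h : e ∈ adjoin 𝒜 v) :
    ∃ a ∈ 𝒜, ∃ b ∈ 𝒜, e = (a ∩ v) ∪ (b \ v) := by
  induction h using BooleanSubalgebra.closure_bot_sup_induction with
  | mem x hx =>
    rcases hx with rfl | hx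
    · exact ⟨Set.univ, univ_mem, ∅, empty_mem, by simp⟩
    · exact ⟨x, hx, x, hx, (Set.inter_union_sdiff x v).symm⟩
  | bot => exact ⟨∅, empty_mem, ∅, empty_mem, by simp⟩
  | sup x _ y _ hx hy =>
    obtain ⟨a, ha, b, hb, rfl⟩ := hx
    obtain ⟨c, hc, d, hd, rfl⟩ := hy
    refine ⟨a ∪ c, union_mem ha hc, b ∪ d, union_mem hb hd, ?_⟩
    ext z
    simp only [Set.sup_eq_union, Set.mem_union, Set.mem_inter_iff, Set.mem_sdiff]
    tauto
  | compl x _ hx =>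
    obtain ⟨a, ha, b, hb, rfl⟩ := hx
    refine ⟨aᶜ, BooleanSubalgebra.compl_mem ha, bᶜ, BooleanSubalgebra.compl_mem hb, ?_⟩
    ext z
    simp only [Set.mem_compl_iff, Set.mem_union, Set.mem_inter_iff, Set.mem_sdiff]
    tauto

theorem diff_mem_of_mem_adjoin (hU : ∀ j, U j ∈ 𝒜) (hv : ∀ j, v \ U j ∈ 𝒜)
    (h : e ∈ adjoin 𝒜 v) (j : ℕ) : e \ U j ∈ 𝒜 := by
  obtain ⟨a, ha, b, hb, rfl⟩ := exists_of_mem_adjoin h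
  have : (a ∩ v ∪ b \ v) \ U j = (a ∩ (v \ U j)) ∪ ((b \ U j) \ (v \ U j)) := by
    ext z
    simp only [Set.mem_union, Set.mem_inter_iff, Set.mem_sdiff]
    tauto
  rw [this]
  exact union_mem (inter_mem ha (hv j)) (diff_mem (diff_mem hb (hU j)) (hv j))

/-- The sets whose adjunction to `𝒜` splits at most one point of the Stone space. -/
def Admissible (𝒜 : BooleanSubalgebra (Set X)) (v : Set X) : Prop :=
  v ∈ 𝒜 ∨ ∃ U, Shrinks 𝒜 U ∧ ∀ j, v \ U j ∈ 𝒜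

theorem Kills.admissible {m : ℕ → Set X → ℝ} (h : Kills 𝒜 m v) : Admissible 𝒜 v := by
  obtain ⟨U, hU, hv, -⟩ := h
  exact Or.inr ⟨U, hU, hv⟩

theorem adjoin_eq_self (h : v ∈ 𝒜) : adjoin 𝒜 v = 𝒜 :=
  le_antisymm (BooleanSubalgebra.closure_le.2 (Set.insert_subset h subset_rfl)) le_adjoin

/-- A member of the extension is, near the split point, trivial or equal to `v` or its complement;
in the last two cases it recovers `v`. -/
theorem inter_cases (v : Set X) (ha : u ⊆ a ∨ Disjoint u a) (hb : u ⊆ b ∨ Disjoint u b) :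
    (a ∩ v ∪ b \ v) ∩ u = u ∨ (a ∩ v ∪ b \ v) ∩ u = ∅ ∨ v ∩ u = (a ∩ v ∪ b \ v) ∩ u ∨
      v ∩ u = u \ (a ∩ v ∪ b \ v) := by
  rw [Set.disjoint_left] at ha hb
  rcases ha with ha | ha <;> rcases hb with hb | hb
  · left; ext z; have := @ha z; have := @hb z; grind
  · right; right; left; ext z; have := @ha z; have := @hb z; grind
  · right; right; right; ext z; have := @ha z; have := @hb z; grind
  · right; left; ext z; have := @ha z; have := @hb z; grind

/-- Away from `U j` the extension adds nothing. A new element must therefore be nontrivial on every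
small `U j`, where by `inter_cases` it agrees with `v` or its complement and so generates `v`. -/
theorem Admissible.isMinimalExtension (h : Admissible 𝒜 v) :
    BooleanAlg.IsMinimalExtension 𝒜 (adjoin 𝒜 v) := by
  refine ⟨le_adjoin, ?_⟩
  rintro ⟨C, hAC, hCT⟩
  rcases h with h | ⟨U, hU, hv⟩
  · rw [adjoin_eq_self h] at hCT
    exact lt_irrefl _ (hAC.trans hCT)
  obtain ⟨hle, y, hyC, hyA⟩ := SetLike.lt_iff_le_and_exists.1 hAC
  refine hCT.not_ge (BooleanSubalgebra.closure_le.2 (Set.insert_subset ?_ hle))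
  have hy := hCT.le hyC
  obtain ⟨a, ha, b, hb, hyab⟩ := exists_of_mem_adjoin hy
  obtain ⟨i, hi⟩ := hU.decides a ha
  obtain ⟨k, hk⟩ := hU.decides b hb
  set j := max i k
  have hi' : U j ⊆ a ∨ Disjoint (U j) a := hi.imp (hU.anti (le_max_left i k)).trans
    fun h => h.mono_left (hU.anti (le_max_left i k))
  have hk' : U j ⊆ b ∨ Disjoint (U j) b := hk.imp (hU.anti (le_max_right i k)).trans
    fun h => h.mono_left (hU.anti (le_max_right i k))
  have hyj : y \ U j ∈ 𝒜 := diff_mem_of_mem_adjoin hU.mem hv hy j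
  have hUj := hU.mem j
  have hvU : v ∩ U j ∈ C → v ∈ C := fun h => by
    rw [← Set.inter_union_sdiff v (U j)]
    exact union_mem h (hle (hv j))
  rcases inter_cases v hi' hk' with h | h | h | h <;> rw [← hyab] at h
  · refine absurd ?_ hyA
    rw [← Set.inter_union_sdiff y (U j), h]
    exact union_mem hUj hyj
  · refine absurd ?_ hyA
    rw [← Set.inter_union_sdiff y (U j), h]
    exact union_mem empty_mem hyj
  · exact hvU (h ▸ inter_mem hyC (hle hUj))
  · exact hvU (h ▸ diff_mem (hle hUj) hyC)

end

/-! ### The continuous chain of stages and transfinite recursion. -/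

/-- The countable ordinals. -/
abbrev CountableOrdinal : Type 1 := Set.Iio (ω₁ : Ordinal.{0})

/-- The subbasic clopen subsets of the Cantor space. -/
def cylinder (n : ℕ) : Set (ℕ → Bool) := {z | z n = true}

/-- The algebra of sets generated by the cylinders and by the sets `y i` for `i < α`. -/
def stage (y : CountableOrdinal → Set (ℕ → Bool)) (α : Ordinal.{0}) :
    BooleanSubalgebra (Set (ℕ → Bool)) :=
  BooleanSubalgebra.closure (Set.range cylinder ∪ {s | ∃ i : CountableOrdinal, i.1 < α ∧ y i = s})

variable {y y' : CountableOrdinal → Set (ℕ → Bool)}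

theorem stage_mono : Monotone (stage y) := fun _ _ h =>
  BooleanSubalgebra.closure_mono (Set.union_subset_union_right _ fun _ ⟨i, hi, hs⟩ =>
    ⟨i, hi.trans_le h, hs⟩)

theorem stage_congr {α : Ordinal.{0}} (h : ∀ i : CountableOrdinal, i.1 < α → y i = y' i) :
    stage y α = stage y' α := by
  unfold stage
  congr 2
  ext s
  constructor <;> rintro ⟨i, hi, rfl⟩
  · exact ⟨i, hi, (h i hi).symm⟩
  · exact ⟨i, hi, h i hi⟩

theorem cylinder_mem_stage (n : ℕ) (α : Ordinal.{0}) : cylinder n ∈ stage y α :=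
  BooleanSubalgebra.subset_closure (Or.inl ⟨n, rfl⟩)

theorem mem_stage {i : CountableOrdinal} {α : Ordinal.{0}} (h : i.1 < α) : y i ∈ stage y α :=
  BooleanSubalgebra.subset_closure (Or.inr ⟨i, h, rfl⟩)

theorem stage_zero : stage y 0 = BooleanSubalgebra.closure (Set.range cylinder) := by
  unfold stage
  congr 1
  ext s
  simp

theorem stage_succ (i : CountableOrdinal) : stage y (Order.succ i.1) = adjoin (stage y i) (y i) := by
  apply le_antisymm
  · refine BooleanSubalgebra.closure_le.2 ?_
    rintro s (⟨n, rfl⟩ | ⟨j, hj, rfl⟩)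
    · exact le_adjoin (cylinder_mem_stage n _)
    · rcases (Order.lt_succ_iff.1 hj).eq_or_lt with h | h
      · rw [Subtype.ext h]; exact mem_adjoin_self
      · exact le_adjoin (mem_stage h)
  · exact BooleanSubalgebra.closure_le.2 (Set.insert_subset (mem_stage (Order.lt_succ i.1))
      (stage_mono (Order.le_succ i.1)))

theorem exists_lt_mem_stage {γ : Ordinal.{0}} (hγ : Order.IsSuccLimit γ) {s : Set (ℕ → Bool)}
    (hs : s ∈ stage y γ) : ∃ α < γ, s ∈ stage y α := by
  induction hs using BooleanSubalgebra.closure_bot_sup_induction with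
  | mem s hs =>
    rcases hs with ⟨n, rfl⟩ | ⟨i, hi, rfl⟩
    · exact ⟨0, pos_of_ne_zero hγ.ne_bot, cylinder_mem_stage n _⟩
    · exact ⟨_, hγ.succ_lt hi, mem_stage (Order.lt_succ i.1)⟩
  | bot => exact ⟨0, pos_of_ne_zero hγ.ne_bot, empty_mem⟩
  | sup s _ t _ hs ht =>
    obtain ⟨α, hα, hs⟩ := hs
    obtain ⟨β, hβ, ht⟩ := ht
    exact ⟨max α β, max_lt hα hβ, union_mem (stage_mono (le_max_left _ _) hs)
      (stage_mono (le_max_right _ _) ht)⟩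
  | compl s _ hs =>
    obtain ⟨α, hα, hs⟩ := hs
    exact ⟨α, hα, BooleanSubalgebra.compl_mem hs⟩

theorem isSuccLimit_omega_one : Order.IsSuccLimit (ω₁ : Ordinal.{0}) :=
  Cardinal.isSuccLimit_omega 1

theorem countable_Iio_of_lt_omega_one {α : Ordinal.{0}} (h : α < ω₁) : (Set.Iio α).Countable := by
  rw [← Cardinal.le_aleph0_iff_set_countable, Cardinal.mk_Iio_ordinal, Cardinal.lift_le_aleph0,
    ← Cardinal.lt_aleph_one_iff]
  rwa [← Cardinal.ord_aleph, Cardinal.lt_ord] at h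

theorem exists_lt_omega_one_ge (f : ℕ → Ordinal.{0}) (h : ∀ n, f n < ω₁) :
    ∃ α < (ω₁ : Ordinal.{0}), ∀ n, f n ≤ α :=
  ⟨⨆ n, f n, Ordinal.iSup_lt_omega_one h, fun n => Ordinal.le_iSup f n⟩

theorem countable_stage {α : Ordinal.{0}} (h : α < ω₁) :
    (stage y α : Set (Set (ℕ → Bool))).Countable := by
  refine BooleanSubalgebra.countable_closure ((Set.countable_range _).union ?_)
  have h2 : {i : CountableOrdinal | i.1 < α}.Countable :=
    (countable_Iio_of_lt_omega_one h).preimage Subtype.val_injective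
  refine (h2.image y).mono ?_
  rintro s ⟨i, hi, rfl⟩
  exact ⟨i, hi, rfl⟩

/-- A countable family from the last stage lies in some countable stage. -/
theorem exists_stage_of_countable {T : Set (Set (ℕ → Bool))} (hT : T.Countable)
    (h : T ⊆ stage y ω₁) : ∃ α < (ω₁ : Ordinal.{0}), T ⊆ stage y α := by
  rcases T.eq_empty_or_nonempty with rfl | hne
  · exact ⟨0, Ordinal.omega_pos 1, Set.empty_subset _⟩
  obtain ⟨f, rfl⟩ := hT.exists_eq_range hne
  choose α hα hf using fun n => exists_lt_mem_stage isSuccLimit_omega_one (h ⟨n, rfl⟩)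
  obtain ⟨β, hβ, hle⟩ := exists_lt_omega_one_ge α hα
  exact ⟨β, hβ, by rintro _ ⟨n, rfl⟩; exact stage_mono (hle n) (hf n)⟩

/-- Transfinite recursion with a relational step. -/
theorem exists_forall_rel_of_wellFoundedLT {I V : Type*} [Preorder I] [WellFoundedLT I] [Nonempty V]
    (R : I → (I → V) → V → Prop)
    (hR : ∀ i y y' v, (∀ j < i, y j = y' j) → R i y v → R i y' v)
    (h : ∀ i y, ∃ v, R i y v) : ∃ x : I → V, ∀ i, R i x (x i) := by
  classical
  choose f hf using h
  let d : V := Classical.arbitrary V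
  -- Values outside the initial segment are filled with a default; `hR` makes them irrelevant.
  let x : I → V := (wellFounded_lt (α := I)).fix fun i g =>
    f i fun j => if hj : j < i then g j hj else d
  have hx : ∀ i, x i = f i fun j => if j < i then x j else d := fun i => by
    simpa using! (wellFounded_lt (α := I)).fix_eq (fun i g =>
      f i fun j => if hj : j < i then g j hj else d) i
  refine ⟨x, fun i => ?_⟩
  rw [hx i]
  exact hR i _ _ _ (fun j hj => if_pos hj) (hf i _)

end SetAlgebra

/-! ### Guessing by diamond, control measures and the Nikodym property. -/

namespace SetAlgebra

theorem isClub_isSuccLimit_ge {α : Ordinal.{0}} (hα : α < ω₁) :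
    IsClub {i : CountableOrdinal | α ≤ i.1 ∧ Order.IsSuccLimit i.1} := by
  constructor
  · rintro d hd ⟨c, hc⟩ - a ha
    have hca : c.1 ≤ a.1 := ha.1 hc
    refine ⟨(hd hc).1.trans hca, ?_, Order.isSuccPrelimit_of_succ_lt fun b hb => ?_⟩
    · have := ((hd hc).2.bot_lt).trans_le hca
      exact this.not_isMin
    · have hbI : b < (ω₁ : Ordinal.{0}) := hb.trans a.2
      have : ¬ (⟨b, hbI⟩ : CountableOrdinal) ∈ upperBounds d := fun h => (ha.2 h).not_gt hb
      simp only [upperBounds, Set.mem_ofPred_eq, not_forall, not_le] at this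
      obtain ⟨e, he, hbe⟩ := this
      exact ((hd he).2.succ_lt hbe).trans_le (ha.1 he)
  · intro i
    -- Adding ω produces a limit above both ordinals, still below ω₁.
    have hlt : max i.1 α + ω < (ω₁ : Ordinal.{0}) :=
      Ordinal.isPrincipal_add_omega 1 (max_lt i.2 hα) Ordinal.omega0_lt_omega_one
    refine ⟨⟨_, hlt⟩, ⟨(le_max_right i.1 α).trans le_self_add,
      Ordinal.isSuccLimit_add _ Ordinal.isSuccLimit_omega0⟩, ?_⟩
    exact (le_max_left i.1 α).trans le_self_add

/-- The diamond principle guesses functions with values in double sequences of reals. -/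
theorem _root_.DiamondPrinciple.exists_guess (h : DiamondPrinciple) :
    ∃ G : (i : CountableOrdinal) → Set.Iio i → ℕ → ℕ → ℝ,
      ∀ g : CountableOrdinal → ℕ → ℕ → ℝ,
        IsStationary {i : CountableOrdinal | ∀ β : Set.Iio i, g β = G i β} := by
  -- Both sides have the cardinality of the continuum, so one point of the Cantor space codes a
  -- double sequence of reals.
  have hcard : Cardinal.mk (ℕ → ℕ → ℝ) = Cardinal.mk (ℕ → Bool) := by
    simp [Cardinal.mk_real]
  obtain ⟨c⟩ := Cardinal.eq.1 hcard
  obtain ⟨F, hF⟩ := h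
  refine ⟨fun i β => c.symm fun n => F i n β, fun g => ?_⟩
  refine (hF fun n i => c (g i) n).mono ?_
  rintro i ⟨-, hi⟩ β
  rw [Equiv.eq_symm_apply]
  ext1 n
  exact hi n β

section

variable {X : Type*} {𝒜 ℬ : BooleanSubalgebra (Set X)} {a b e u v : Set X} {U : ℕ → Set X}

open Classical in
/-- An enumeration of a countable algebra of sets. -/
noncomputable def enumerate (𝒜 : BooleanSubalgebra (Set X)) : ℕ → Set X :=
  if h : ∃ f : ℕ → Set X, (𝒜 : Set (Set X)) = Set.range f then h.choose else fun _ => ∅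

theorem range_enumerate (h : (𝒜 : Set (Set X)).Countable) : Set.range (enumerate 𝒜) = 𝒜 := by
  have h' : ∃ f : ℕ → Set X, (𝒜 : Set (Set X)) = Set.range f :=
    h.exists_eq_range ⟨∅, empty_mem⟩
  rw [enumerate, dif_pos h']
  exact h'.choose_spec.symm

/-- A positive measure is, up to `ε`, two-valued on the pieces of a suitable finite cover. -/
theorem IsFinAdd.exists_finite_cover {ν : Set X → ℝ} (hν : IsFinAdd 𝒜 ν) (h0 : ∀ a ∈ 𝒜, 0 ≤ ν a)
    {ε : ℝ} (hε : 0 < ε) :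
    ∃ P : Set (Set X), P.Finite ∧ P ⊆ 𝒜 ∧ ⋃₀ P = Set.univ ∧
      ∀ p ∈ P, ∀ y ∈ 𝒜, ν (p ∩ y) ≤ ε ∨ ν (p \ y) ≤ ε := by
  -- Induction on the number of units ε of mass: if `q` is not two-valued up to ε, some `y` cuts it
  -- into halves of mass above ε, so each half loses one unit.
  have key : ∀ (k : ℕ), ∀ q ∈ 𝒜, ν q ≤ k * ε →
      ∃ P : Set (Set X), P.Finite ∧ P ⊆ 𝒜 ∧ q ⊆ ⋃₀ P ∧
        ∀ p ∈ P, ∀ y ∈ 𝒜, ν (p ∩ y) ≤ ε ∨ ν (p \ y) ≤ ε := by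
    intro k
    induction k with
    | zero =>
      intro q hq hle
      refine ⟨{q}, Set.finite_singleton q, by simpa using hq, by simp, ?_⟩
      rintro _ rfl y hy
      left
      have := hν.mono_of_nonneg h0 (inter_mem hq hy) hq Set.inter_subset_left
      simp at hle
      linarith
    | succ k ih =>
      intro q hq hle
      by_cases hgood : ∀ y ∈ 𝒜, ν (q ∩ y) ≤ ε ∨ ν (q \ y) ≤ ε
      · exact ⟨{q}, Set.finite_singleton q, by simpa using hq, by simp, by simpa using hgood⟩
      · push Not at hgood
        obtain ⟨y, hy, h1, h2⟩ := hgood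
        have h3 := hν.inter_add_diff hq hy
        push_cast at hle
        obtain ⟨P, hP, hPA, hPc, hPg⟩ := ih (q ∩ y) (inter_mem hq hy) (by linarith)
        obtain ⟨Q, hQ, hQA, hQc, hQg⟩ := ih (q \ y) (diff_mem hq hy) (by linarith)
        refine ⟨P ∪ Q, hP.union hQ, Set.union_subset hPA hQA, ?_, ?_⟩
        · rw [Set.sUnion_union, ← Set.inter_union_sdiff q y]
          exact Set.union_subset_union hPc hQc
        · rintro p (hp | hp)
          exacts [hPg p hp, hQg p hp]
  obtain ⟨k, hk⟩ := exists_nat_ge (ν Set.univ / ε)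
  rw [div_le_iff₀ hε] at hk
  obtain ⟨P, hP, hPA, hPc, hPg⟩ := key k Set.univ univ_mem hk
  exact ⟨P, hP, hPA, Set.univ_subset_iff.1 hPc, hPg⟩

theorem Shrinks.exists_subset_of_cover (hU : Shrinks 𝒜 U) {P : Set (Set X)} (hP : P.Finite)
    (hPA : P ⊆ 𝒜) (hcov : ⋃₀ P = Set.univ) : ∃ p ∈ P, ∃ j, U j ⊆ p := by
  by_contra! hcon
  have h1 : ∀ p ∈ P, ∃ j, Disjoint (U j) p := fun p hp => by
    obtain ⟨j, hj⟩ := hU.decides p (hPA hp)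
    exact ⟨j, hj.resolve_left (hcon p hp j)⟩
  choose! f hf using h1
  obtain ⟨N, hN⟩ := (hP.image f).bddAbove
  obtain ⟨z, hz⟩ := hU.nonempty N
  obtain ⟨p, hp, hzp⟩ : z ∈ ⋃₀ P := hcov ▸ Set.mem_univ z
  exact Set.disjoint_left.1 (hf p hp) (hU.anti (hN ⟨p, hp, rfl⟩) hz) hzp

/-- Countably many bounded measures have a common positive control measure. -/
theorem exists_common_majorant {m : ℕ → Set X → ℝ} (hm : ∀ n, IsFinAdd 𝒜 (m n)) :
    ∃ ν, IsFinAdd 𝒜 ν ∧ (∀ a ∈ 𝒜, 0 ≤ ν a) ∧ ∀ n, ∃ C, ∀ a ∈ 𝒜, |m n a| ≤ C * ν a := by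
  choose ν hν hmν using fun n => (hm n).exists_majorant
  choose B hB using fun n => (hν n).bdd
  have hν0 : ∀ n, ∀ a ∈ 𝒜, 0 ≤ ν n a := fun n a ha => (abs_nonneg _).trans (hmν n a ha)
  have hB0 : ∀ n, 0 ≤ B n := fun n => (abs_nonneg _).trans (hB n ∅ empty_mem)
  -- These weights make the sum of the variations converge, dominated by a geometric series.
  set w : ℕ → ℝ := fun n => (1 / 2) ^ n / (B n + 1) with hw
  have hw0 : ∀ n, 0 < w n := fun n => div_pos (by positivity) (by linarith [hB0 n])
  have hnn : ∀ n, ∀ a ∈ 𝒜, 0 ≤ w n * ν n a := fun n a ha => mul_nonneg (hw0 n).le (hν0 n a ha)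
  have hle : ∀ n, ∀ a ∈ 𝒜, w n * ν n a ≤ (1 / 2) ^ n := fun n a ha => by
    have h1 := (abs_le.1 (hB n a ha)).2
    have h2 : 0 < B n + 1 := by linarith [hB0 n]
    rw [hw, div_mul_eq_mul_div, div_le_iff₀ h2]
    exact mul_le_mul_of_nonneg_left (by linarith) (by positivity)
  have hs : ∀ a ∈ 𝒜, Summable fun n => w n * ν n a := fun a ha =>
    Summable.of_nonneg_of_le (fun n => hnn n a ha) (fun n => hle n a ha) summable_geometric_two
  refine ⟨fun a => ∑' n, w n * ν n a, ⟨fun a ha b hb hab => ?_, 2, fun a ha => ?_⟩,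
    fun a ha => tsum_nonneg fun n => hnn n a ha, fun n => ⟨(w n)⁻¹, fun a ha => ?_⟩⟩
  · rw [← (hs a ha).tsum_add (hs b hb)]
    congr 1
    ext n
    rw [(hν n).add a ha b hb hab, mul_add]
  · rw [abs_of_nonneg (tsum_nonneg fun n => hnn n a ha), ← tsum_geometric_two]
    exact (hs a ha).tsum_le_tsum (fun n => hle n a ha) summable_geometric_two
  · rw [inv_mul_eq_div, le_div_iff₀ (hw0 n), mul_comm]
    refine (mul_le_mul_of_nonneg_left (hmν n a ha) (hw0 n).le).trans ?_
    exact (hs a ha).le_tsum n fun k _ => hnn k a ha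

theorem tendsto_zero_or_tendsto_zero {f g : ℕ → ℝ} (hf : Antitone f) (hg : Antitone g)
    (hf0 : ∀ j, 0 ≤ f j) (hg0 : ∀ j, 0 ≤ g j) (h : ∀ ε > 0, ∃ j, f j ≤ ε ∨ g j ≤ ε) :
    Tendsto f atTop (𝓝 0) ∨ Tendsto g atTop (𝓝 0) := by
  have hbf : BddBelow (Set.range f) := ⟨0, by rintro _ ⟨j, rfl⟩; exact hf0 j⟩
  have hbg : BddBelow (Set.range g) := ⟨0, by rintro _ ⟨j, rfl⟩; exact hg0 j⟩
  have h1 := tendsto_atTop_ciInf hf hbf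
  have h2 := tendsto_atTop_ciInf hg hbg
  rcases (le_ciInf hf0).eq_or_lt with h3 | h3
  · left; rwa [← h3] at h1
  rcases (le_ciInf hg0).eq_or_lt with h4 | h4
  · right; rwa [← h4] at h2
  obtain ⟨j, hj | hj⟩ := h (min (⨅ j, f j) (⨅ j, g j) / 2) (by positivity)
  · have := ciInf_le hbf j
    have := min_le_left (⨅ j, f j) (⨅ j, g j)
    linarith
  · have := ciInf_le hbg j
    have := min_le_right (⨅ j, f j) (⨅ j, g j)
    linarith

end

/-- The set-theoretic form of the Nikodym property. -/
def IsNikodym {X : Type*} (𝒜 : BooleanSubalgebra (Set X)) : Prop :=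
  ∀ m, ¬ IsAntiNikodym 𝒜 m

/-- `m` is an anti-Nikodym sequence on the stage `i` with the prescribed values. -/
def Guessed (G : (i : CountableOrdinal) → Set.Iio i → ℕ → ℕ → ℝ)
    (y : CountableOrdinal → Set (ℕ → Bool)) (i : CountableOrdinal)
    (m : ℕ → Set (ℕ → Bool) → ℝ) : Prop :=
  IsAntiNikodym (stage y i) m ∧
    ∀ (β : Set.Iio i) (n k : ℕ), m n (enumerate (stage y β.1) k) = G i β n k

/-- The set killed for at `i` may come from another sequence than the given one, but both have the
prescribed values on all earlier stages. When nothing is guessed, the empty set is adjoined and the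
stage is unchanged. -/
theorem exists_generators (G : (i : CountableOrdinal) → Set.Iio i → ℕ → ℕ → ℝ) :
    ∃ x : CountableOrdinal → Set (ℕ → Bool), ∀ i : CountableOrdinal, Admissible (stage x i) (x i) ∧
      ((∃ m, Guessed G x i m) → ∃ m, Guessed G x i m ∧ Kills (stage x i) m (x i)) := by
  refine exists_forall_rel_of_wellFoundedLT (fun i y v => Admissible (stage y i) v ∧
      ((∃ m, Guessed G y i m) → ∃ m, Guessed G y i m ∧ Kills (stage y i) m v)) ?_ ?_
  · intro i y y' v h hv
    have h1 : stage y i = stage y' i := stage_congr fun j hj => h j hj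
    have h2 : ∀ m, Guessed G y i m ↔ Guessed G y' i m := fun m => by
      unfold Guessed
      rw [h1]
      refine and_congr_right fun _ => forall_congr' fun β => ?_
      rw [stage_congr (y := y) (y' := y') fun j hj => h j (lt_trans hj β.2)]
    simp only [h1, h2] at hv
    exact hv
  · intro i y
    by_cases h : ∃ m, Guessed G y i m
    · obtain ⟨m, hm⟩ := h
      obtain ⟨v, hv⟩ := hm.1.exists_kills (countable_stage i.2)
      exact ⟨v, hv.admissible, fun _ => ⟨m, hm, hv⟩⟩
    · exact ⟨∅, Or.inl empty_mem, fun h' => absurd h' h⟩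

/-- Once the witnesses of unboundedness and the covers for the control measure have appeared, a
correct guess at a limit stage `i` kills `m` itself, provided the mass at the split point lies on
one side of `x i`. -/
theorem isNikodym_of_generators {G : (i : CountableOrdinal) → Set.Iio i → ℕ → ℕ → ℝ}
    (hG : ∀ g : CountableOrdinal → ℕ → ℕ → ℝ,
      IsStationary {i : CountableOrdinal | ∀ β : Set.Iio i, g β = G i β})
    {x : CountableOrdinal → Set (ℕ → Bool)}
    (hx : ∀ i : CountableOrdinal, (∃ m, Guessed G x i m) → ∃ m, Guessed G x i m ∧ Kills (stage x i) m (x i)) :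
    IsNikodym (stage x ω₁) := by
  intro m hm
  choose n a ha hlt using fun N : ℕ => hm.unbounded N
  obtain ⟨ν, hν, hν0, hmν⟩ := exists_common_majorant hm.finAdd
  choose P hPfin hPA hPcov hPgood using fun N : ℕ =>
    hν.exists_finite_cover hν0 (Nat.one_div_pos_of_nat (α := ℝ) (n := N))
  obtain ⟨α, hα, hαT⟩ := exists_stage_of_countable (y := x) (T := Set.range a ∪ ⋃ N, P N)
    ((Set.countable_range a).union (Set.countable_iUnion fun N => (hPfin N).countable))
    (Set.union_subset (by rintro _ ⟨N, rfl⟩; exact ha N) (Set.iUnion_subset hPA))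
  obtain ⟨i, hig, hαi, hlim⟩ := hG (fun β n k => m n (enumerate (stage x β) k))
    (isClub_isSuccLimit_ge hα)
  have hle : stage x i ≤ stage x ω₁ := stage_mono i.2.le
  have hguess : Guessed G x i m := by
    refine ⟨⟨fun n => (hm.finAdd n).mono hle, fun a ha => hm.pointwise a (hle ha), fun C => ?_⟩,
      fun β n k => congrFun (congrFun (hig β) n) k⟩
    obtain ⟨N, hN⟩ := exists_nat_ge C
    exact ⟨n N, a N, stage_mono hαi (hαT (Or.inl ⟨N, rfl⟩)), hN.trans_lt (hlt N)⟩
  obtain ⟨m₀, hm₀, U, hU, hxU, hkill⟩ := hx i ⟨m, hguess⟩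
  have hxi : x i ∈ stage x ω₁ := mem_stage i.2
  refine hkill (stage x ω₁) m hle hxi hm.finAdd ?_ ?_ (hm.pointwise _ hxi)
  -- At a limit every element occurs in an earlier stage, where the guess fixes its value for both
  -- sequences.
  · intro n a ha
    obtain ⟨β, hβ, haβ⟩ := exists_lt_mem_stage hlim ha
    have hβI : β < (ω₁ : Ordinal.{0}) := hβ.trans i.2
    rw [← SetLike.mem_coe, ← range_enumerate (countable_stage hβI)] at haβ
    obtain ⟨k, rfl⟩ := haβ
    exact (hguess.2 ⟨⟨β, hβI⟩, hβ⟩ n k).trans (hm₀.2 ⟨⟨β, hβI⟩, hβ⟩ n k).symm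
  · have hvU : ∀ j, x i ∩ U j ∈ stage x ω₁ := fun j => inter_mem hxi (hle (hU.mem j))
    have hUv : ∀ j, U j \ x i ∈ stage x ω₁ := fun j => diff_mem (hle (hU.mem j)) hxi
    -- The single control measure forces the same side for every `n`.
    have hsq : ∀ (s : ℕ → Set (ℕ → Bool)), (∀ j, s j ∈ stage x ω₁) →
        Tendsto (fun j => ν (s j)) atTop (𝓝 0) → ∀ n, Tendsto (fun j => m n (s j)) atTop (𝓝 0) := by
      intro s hs hs0 n
      obtain ⟨C, hC⟩ := hmν n
      refine squeeze_zero_norm (fun j => hC _ (hs j)) ?_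
      simpa using hs0.const_mul C
    refine (tendsto_zero_or_tendsto_zero (f := fun j => ν (x i ∩ U j)) (g := fun j => ν (U j \ x i))
      (fun j k hjk => hν.mono_of_nonneg hν0 (hvU k) (hvU j)
        (Set.inter_subset_inter_right _ (hU.anti hjk)))
      (fun j k hjk => hν.mono_of_nonneg hν0 (hUv k) (hUv j)
        (Set.sdiff_subset_sdiff_left (hU.anti hjk)))
      (fun j => hν0 _ (hvU j)) (fun j => hν0 _ (hUv j)) fun ε hε => ?_).imp
        (hsq _ hvU) (hsq _ hUv)
    obtain ⟨N, hN⟩ := exists_nat_one_div_lt hε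
    obtain ⟨p, hp, j, hj⟩ := hU.exists_subset_of_cover (hPfin N)
      (fun p hp => stage_mono hαi (hαT (Or.inr (Set.mem_iUnion.2 ⟨N, hp⟩)))) (hPcov N)
    have hpA := hPA N hp
    refine ⟨j, (hPgood N p hp (x i) hxi).imp (fun h => ?_) fun h => ?_⟩
    · refine (hν.mono_of_nonneg hν0 (hvU j) (inter_mem hpA hxi) ?_).trans (h.trans hN.le)
      exact fun z hz => ⟨hj hz.2, hz.1⟩
    · exact (hν.mono_of_nonneg hν0 (hUv j) (diff_mem hpA hxi)
        (Set.sdiff_subset_sdiff_left hj)).trans (h.trans hN.le)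

end SetAlgebra

/-! ### Uniformly distributed sequences from uniform regularity. -/

namespace BooleanAlg

open MeasureTheory ProbabilityTheory

section UniformDistribution

variable {K : Type*} [MeasurableSpace K]

theorem IsZeroSet.measurableSet [TopologicalSpace K] [BorelSpace K] {F : Set K} (hF : IsZeroSet F) : MeasurableSet F := by
  obtain ⟨f, rfl⟩ := hF
  exact (isClosed_eq f.continuous continuous_const).measurableSet

/-- The empirical measure of the first `n` points of a sequence. -/
noncomputable def empirical (x : ℕ → K) (n : ℕ) : Measure K :=
  (n : ℝ≥0∞)⁻¹ • ∑ i ∈ Finset.range n, Measure.dirac (x i)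

theorem isProbabilityMeasure_empirical_succ (x : ℕ → K) (n : ℕ) :
    IsProbabilityMeasure (empirical x (n + 1)) := by
  constructor
  simp only [empirical, Measure.smul_apply, Measure.finsetSum_apply, measure_univ,
    Finset.sum_const, Finset.card_range, nsmul_eq_mul, mul_one, smul_eq_mul]
  exact ENNReal.inv_mul_cancel (by simp) (by simp)

theorem empirical_apply (x : ℕ → K) (n : ℕ) {F : Set K} (hF : MeasurableSet F) :
    empirical x (n + 1) F =
      ENNReal.ofReal ((∑ i ∈ Finset.range (n + 1), F.indicator 1 (x i)) / ((n + 1 : ℕ) : ℝ)) := by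
  have h : ∀ i, (Measure.dirac (x i)) F = ENNReal.ofReal (F.indicator 1 (x i)) := fun i => by
    rw [Measure.dirac_apply' _ hF]
    by_cases hx : x i ∈ F <;> simp [hx]
  simp only [empirical, Measure.smul_apply, Measure.finsetSum_apply, h, smul_eq_mul]
  rw [← ENNReal.ofReal_sum_of_nonneg fun i _ => Set.indicator_nonneg (by simp) _,
    ENNReal.ofReal_div_of_pos (by positivity), ENNReal.ofReal_natCast, mul_comm,
    ENNReal.div_eq_inv_mul, mul_comm]

/-- A random sequence is uniformly distributed with respect to countably many given sets. -/
theorem exists_seq_tendsto_average (μ : Measure K) [IsProbabilityMeasure μ] {𝒞 : Set (Set K)}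
    (h𝒞 : 𝒞.Countable) (hmeas : ∀ F ∈ 𝒞, MeasurableSet F) :
    ∃ x : ℕ → K, ∀ F ∈ 𝒞, Tendsto
      (fun n : ℕ => (∑ i ∈ Finset.range n, F.indicator (1 : K → ℝ) (x i)) / (n : ℝ)) atTop
      (𝓝 (μ.real F)) := by
  have h : ∀ᵐ x ∂(Measure.infinitePi fun _ : ℕ => μ), ∀ F ∈ 𝒞, Tendsto
      (fun n : ℕ => (∑ i ∈ Finset.range n, F.indicator (1 : K → ℝ) (x i)) / (n : ℝ)) atTop
      (𝓝 (μ.real F)) := by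
    rw [ae_ball_iff h𝒞]
    intro F hF
    have hFm : Measurable (F.indicator (1 : K → ℝ)) := measurable_one.indicator (hmeas F hF)
    have hmp : ∀ i, MeasurePreserving (fun x : ℕ → K => x i) (Measure.infinitePi fun _ => μ) μ :=
      fun i => measurePreserving_eval_infinitePi (fun _ => μ) i
    have hint : Integrable (F.indicator (1 : K → ℝ)) μ :=
      (integrable_const (1 : ℝ)).indicator (hmeas F hF)
    have key := strong_law_ae_real (μ := Measure.infinitePi fun _ : ℕ => μ)
      (fun i x => F.indicator (1 : K → ℝ) (x i)) ((hmp 0).integrable_comp_of_integrable hint)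
      (fun i j hij => (iIndepFun_infinitePi (P := fun _ : ℕ => μ)
        (X := fun _ => F.indicator (1 : K → ℝ)) fun _ => hFm).indepFun hij)
      (fun i => by
        have hid : IdentDistrib (fun x : ℕ → K => x i) (fun x : ℕ → K => x 0)
            (Measure.infinitePi fun _ => μ) (Measure.infinitePi fun _ => μ) :=
          ⟨(hmp i).measurable.aemeasurable, (hmp 0).measurable.aemeasurable,
            (hmp i).map_eq.trans (hmp 0).map_eq.symm⟩
        exact hid.comp hFm)
    have hI : ∫ x, F.indicator (1 : K → ℝ) (x 0) ∂(Measure.infinitePi fun _ : ℕ => μ) =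
        μ.real F := by
      rw [← integral_indicator_one (hmeas F hF)]
      have := integral_map (hmp 0).measurable.aemeasurable
        (hFm.aestronglyMeasurable (μ := (Measure.infinitePi fun _ => μ).map fun x : ℕ → K => x 0))
      rw [← this, (hmp 0).map_eq]
    rwa [hI] at key
  exact h.exists

/-- By the portmanteau theorem it suffices to bound the liminf on open sets from below, and there
the countable family approximates from inside. -/
theorem IsUniformlyRegular.exists_isUniformlyDistributed [TopologicalSpace K] [BorelSpace K]
    [CompactSpace K] {μ : Measure K} [IsProbabilityMeasure μ]
    (h : IsUniformlyRegular μ) : ∃ x : ℕ → K, IsUniformlyDistributed μ x := by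
  obtain ⟨𝒞, h𝒞, hzero, happrox⟩ := h
  obtain ⟨x, hx⟩ := exists_seq_tendsto_average μ h𝒞 fun F hF => (hzero F hF).measurableSet
  refine ⟨x, fun f => ?_⟩
  -- The index is shifted because the empirical measure of no points is zero, not a probability.
  let P : ℕ → ProbabilityMeasure K := fun n =>
    ⟨empirical x (n + 1), isProbabilityMeasure_empirical_succ x n⟩
  let Q : ProbabilityMeasure K := ⟨μ, inferInstance⟩
  have hF : ∀ F ∈ 𝒞, Tendsto (fun n => empirical x (n + 1) F) atTop (𝓝 (μ F)) := by
    intro F hF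
    have h1 := ENNReal.tendsto_ofReal ((tendsto_add_atTop_iff_nat 1).2 (hx F hF))
    rw [ofReal_measureReal] at h1
    exact h1.congr fun n => (empirical_apply x n (hzero F hF).measurableSet).symm
  have hP : Tendsto P atTop (𝓝 Q) := by
    refine tendsto_of_forall_isOpen_le_liminf_nat' fun G hG => ?_
    refine ENNReal.le_of_forall_pos_le_add fun ε hε _ => ?_
    obtain ⟨F, hFC, hFG, hlt⟩ := happrox G hG ε (by exact_mod_cast hε)
    have h1 : μ F ≤ liminf (fun n => empirical x (n + 1) G) atTop := by
      rw [← (hF F hFC).liminf_eq]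
      exact liminf_le_liminf (Eventually.of_forall fun n => measure_mono hFG)
    calc μ G ≤ μ F + μ (G \ F) := by
          rw [← measure_union_add_inter' ((hzero F hFC).measurableSet)]
          exact le_add_right (measure_mono (by rw [Set.union_sdiff_self]; exact Set.subset_union_right))
      _ ≤ _ := add_le_add h1 hlt.le
  have h2 := ProbabilityMeasure.tendsto_iff_forall_integral_tendsto.1 hP
    (BoundedContinuousFunction.mkOfCompact f)
  exact (tendsto_add_atTop_iff_nat 1).1 h2

end UniformDistribution

end BooleanAlg

/-! ### Stone duality and freeness of the cylinder algebra. -/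

namespace BooleanAlg

open MeasureTheory

section Stone

variable {A : Type*} [BooleanAlgebra A]

namespace IsUltrafilterOn

variable {U : Set A} {a b : A}

theorem inf_mem_iff (hU : IsUltrafilterOn U) : a ⊓ b ∈ U ↔ a ∈ U ∧ b ∈ U :=
  ⟨fun h => ⟨hU.mem_of_le h inf_le_left, hU.mem_of_le h inf_le_right⟩, fun h => hU.inf_mem h.1 h.2⟩

theorem compl_mem_iff (hU : IsUltrafilterOn U) : aᶜ ∈ U ↔ a ∉ U := by
  refine ⟨fun h h' => hU.bot_notMem ?_, (hU.mem_or_compl_mem a).resolve_left⟩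
  simpa using hU.inf_mem h' h

theorem sup_mem_iff (hU : IsUltrafilterOn U) : a ⊔ b ∈ U ↔ a ∈ U ∨ b ∈ U := by
  rw [← not_iff_not, ← hU.compl_mem_iff, compl_sup, hU.inf_mem_iff, hU.compl_mem_iff,
    hU.compl_mem_iff, not_or]

end IsUltrafilterOn

namespace StoneSpace

/-- The clopen subset of the Stone space given by an element of the algebra. -/
def basic (a : A) : Set (StoneSpace A) := {U | a ∈ U.1}

theorem mem_basic {a : A} {U : StoneSpace A} : U ∈ basic a ↔ a ∈ U.1 := Iff.rfl

theorem isOpen_basic (a : A) : IsOpen (basic a) :=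
  TopologicalSpace.isOpen_generateFrom_of_mem ⟨a, rfl⟩

theorem basic_compl (a : A) : basic aᶜ = (basic a)ᶜ := by
  ext U; exact U.2.compl_mem_iff

theorem basic_sup (a b : A) : basic (a ⊔ b) = basic a ∪ basic b := by
  ext U; exact U.2.sup_mem_iff

theorem basic_inf (a b : A) : basic (a ⊓ b) = basic a ∩ basic b := by
  ext U; exact U.2.inf_mem_iff

theorem basic_bot : basic (⊥ : A) = ∅ := by
  ext U; simpa [mem_basic] using U.2.bot_notMem

theorem basic_top : basic (⊤ : A) = Set.univ := by
  ext U; simpa [mem_basic] using U.2.top_mem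

theorem basic_sdiff (a b : A) : basic (a \ b) = basic a \ basic b := by
  rw [sdiff_eq, basic_inf, basic_compl]; rfl

theorem basic_mono {a b : A} (h : a ≤ b) : basic a ⊆ basic b := fun U hU => U.2.mem_of_le hU h

theorem isClopen_basic (a : A) : IsClopen (basic a) :=
  ⟨by rw [← isOpen_compl_iff, ← basic_compl]; exact isOpen_basic _, isOpen_basic a⟩

theorem isTopologicalBasis_basic :
    TopologicalSpace.IsTopologicalBasis (Set.range (basic : A → Set (StoneSpace A))) where
  exists_subset_inter := by
    rintro _ ⟨a, rfl⟩ _ ⟨b, rfl⟩ U hU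
    exact ⟨_, ⟨a ⊓ b, rfl⟩, by rwa [basic_inf], by rw [basic_inf]⟩
  sUnion_eq := Set.eq_univ_of_forall fun U => ⟨_, ⟨⊤, rfl⟩, U.2.top_mem⟩
  eq_generateFrom := rfl

theorem isClosed_singleton (U : StoneSpace A) : IsClosed {U} := by
  have : {U} = ⋂ a ∈ U.1, basic a := by
    ext V
    simp only [Set.mem_singleton_iff, Set.mem_iInter]
    refine ⟨by rintro rfl a ha; exact ha, fun h => Subtype.ext (Set.Subset.antisymm ?_ h)⟩
    intro a ha
    by_contra ha'
    exact V.2.compl_mem_iff.1 (h _ (U.2.compl_mem_iff.2 ha')) ha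
  rw [this]
  exact isClosed_biInter fun a _ => (isClopen_basic a).1

instance : CompactSpace (StoneSpace A) := by
  refine ⟨isCompact_iff_ultrafilter_le_nhds.2 fun 𝒰 _ => ?_⟩
  have hW : IsUltrafilterOn {a : A | basic a ∈ 𝒰} := by
    constructor
    · change basic ⊤ ∈ 𝒰
      rw [basic_top]; exact univ_mem
    · change basic ⊥ ∉ 𝒰
      rw [basic_bot]; exact 𝒰.empty_notMem
    · intro a b ha hb
      change basic (a ⊓ b) ∈ 𝒰
      rw [basic_inf]; exact inter_mem ha hb
    · exact fun a b ha hab => mem_of_superset ha (basic_mono hab)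
    · intro a
      change basic a ∈ 𝒰 ∨ basic aᶜ ∈ 𝒰
      rw [basic_compl]; exact 𝒰.mem_or_compl_mem (basic a)
  let W : StoneSpace A := ⟨_, hW⟩
  refine ⟨W, Set.mem_univ _, (isTopologicalBasis_basic.nhds_hasBasis (a := W)).ge_iff.2 ?_⟩
  rintro _ ⟨⟨a, rfl⟩, ha⟩
  exact ha

theorem exists_mem_of_ne_bot {a : A} (ha : a ≠ ⊥) : ∃ U : StoneSpace A, a ∈ U.1 := by
  obtain ⟨J, hJ, -, hdisj⟩ := DistribLattice.prime_ideal_of_disjoint_filter_ideal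
    (F := Order.PFilter.principal a) (I := Order.Ideal.principal (⊥ : A)) (by
      rw [Set.disjoint_left]
      intro b hb hb'
      have h1 : a ≤ b := by simpa using hb
      have h2 : b = ⊥ := le_bot_iff.1 (Order.Ideal.mem_principal.1 hb')
      exact ha (le_bot_iff.1 (h2 ▸ h1)))
  have htop : ⊤ ∉ J := fun h => hJ.1.ne_univ
    (Set.eq_univ_of_forall fun b => J.lower le_top h)
  refine ⟨⟨{b | b ∉ J}, htop, fun h => h J.bot_mem, fun b c hb hc h => ?_,
    fun b c hb hbc h => hb (J.lower hbc h), fun b => ?_⟩, ?_⟩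
  · exact (hJ.mem_or_mem h).elim hb hc
  · by_contra! h
    simp only [Set.mem_ofPred_eq, not_not] at h
    exact htop (by simpa using J.sup_mem h.1 h.2)
  · exact fun h => Set.disjoint_left.1 hdisj (show a ∈ Order.PFilter.principal a by simp) h

theorem basic_injective : Function.Injective (basic : A → Set (StoneSpace A)) := by
  have key : ∀ a b : A, basic a ⊆ basic b → a ≤ b := by
    intro a b h
    by_contra hab
    have : a \ b ≠ ⊥ := fun h0 => hab (sdiff_eq_bot_iff.1 h0)
    obtain ⟨U, hU⟩ := exists_mem_of_ne_bot this
    rw [← mem_basic, basic_sdiff] at hU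
    exact hU.2 (h hU.1)
  exact fun a b h => le_antisymm (key a b h.subset) (key b a h.superset)

theorem exists_basic_between {C U : Set (StoneSpace A)} (hC : IsCompact C) (hU : IsOpen U)
    (hCU : C ⊆ U) : ∃ a : A, C ⊆ basic a ∧ basic a ⊆ U := by
  refine hC.induction_on (p := fun s => ∃ a : A, s ⊆ basic a ∧ basic a ⊆ U) ?_ ?_ ?_ ?_
  · exact ⟨⊥, Set.empty_subset _, by simp [basic_bot]⟩
  · exact fun s t hst ht => ht.imp fun a ha => ⟨hst.trans ha.1, ha.2⟩
  · rintro s t ⟨a, hsa, haU⟩ ⟨b, htb, hbU⟩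
    refine ⟨a ⊔ b, ?_, ?_⟩ <;> rw [basic_sup]
    exacts [Set.union_subset_union hsa htb, Set.union_subset haU hbU]
  · intro V hV
    obtain ⟨_, ⟨a, rfl⟩, hVa, haU⟩ :=
      isTopologicalBasis_basic.exists_subset_of_mem_open (hCU hV) hU
    exact ⟨basic a, mem_nhdsWithin_of_mem_nhds ((isOpen_basic a).mem_nhds hVa), a, subset_rfl, haU⟩

end StoneSpace

theorem _root_.IsClopen.isZeroSet {K : Type*} [TopologicalSpace K] {F : Set K} (hF : IsClopen F) :
    IsZeroSet F := by
  refine ⟨⟨Fᶜ.indicator 1, hF.compl.continuous_indicator continuous_const⟩, ?_⟩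
  ext x
  simp

end Stone

section Free

variable {B : Type*} [BooleanAlgebra B]

theorem hom_eq_of_closure_eq_top {C : Type*} [BooleanAlgebra C] {g : ℕ → B}
    (hg : BooleanSubalgebra.closure (Set.range g) = ⊤) {φ ψ : BoundedLatticeHom B C}
    (h : ∀ n, φ (g n) = ψ (g n)) : φ = ψ := by
  ext b
  have hb : b ∈ BooleanSubalgebra.closure (Set.range g) := hg ▸ BooleanSubalgebra.mem_top
  induction hb using BooleanSubalgebra.closure_bot_sup_induction with
  | mem x hx => obtain ⟨n, rfl⟩ := hx; exact h n
  | bot => simp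
  | sup x _ y _ hx hy => rw [SupHomClass.map_sup, SupHomClass.map_sup, hx, hy]
  | compl x _ hx => rw [map_compl', map_compl', hx]

/-- An algebra generated by a copy of the cylinders of the Cantor space is free. -/
theorem isFreeOnCountable_of_cylinder (ι : BoundedLatticeHom B (Set (ℕ → Bool))) {g : ℕ → B}
    (hg : BooleanSubalgebra.closure (Set.range g) = ⊤)
    (hι : ∀ n, ι (g n) = SetAlgebra.cylinder n) : IsFreeOnCountable B := by
  classical
  refine ⟨g, fun C _ f => ?_⟩
  -- This is the Stone dual of the wanted homomorphism, which sends `b` to the element whose clopen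
  -- set is the preimage of `ι b` under `p`.
  let p : StoneSpace C → ℕ → Bool := fun V n => decide (f n ∈ V.1)
  have key : ∀ b : B, ∃ c : C, StoneSpace.basic c = p ⁻¹' ι b := by
    intro b
    have hb : b ∈ BooleanSubalgebra.closure (Set.range g) := hg ▸ BooleanSubalgebra.mem_top
    induction hb using BooleanSubalgebra.closure_bot_sup_induction with
    | mem x hx =>
      obtain ⟨n, rfl⟩ := hx
      refine ⟨f n, ?_⟩
      ext V
      simp [hι, SetAlgebra.cylinder, p, StoneSpace.mem_basic]
    | bot => exact ⟨⊥, by simp [StoneSpace.basic_bot]⟩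
    | sup x _ y _ hx hy =>
      obtain ⟨c, hc⟩ := hx
      obtain ⟨d, hd⟩ := hy
      exact ⟨c ⊔ d, by rw [StoneSpace.basic_sup, hc, hd, SupHomClass.map_sup]; rfl⟩
    | compl x _ hx =>
      obtain ⟨c, hc⟩ := hx
      exact ⟨cᶜ, by rw [StoneSpace.basic_compl, hc, map_compl']; rfl⟩
  choose φ hφ using key
  refine ⟨⟨⟨⟨φ, fun a b => ?_⟩, fun a b => ?_⟩, ?_, ?_⟩, fun n => ?_, fun ψ hψ => ?_⟩
  · apply StoneSpace.basic_injective
    rw [StoneSpace.basic_sup, hφ, hφ, hφ, SupHomClass.map_sup]; rfl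
  · apply StoneSpace.basic_injective
    change StoneSpace.basic (φ (a ⊓ b)) = StoneSpace.basic (φ a ⊓ φ b)
    rw [StoneSpace.basic_inf, hφ, hφ, hφ, InfHomClass.map_inf]; rfl
  · apply StoneSpace.basic_injective
    change StoneSpace.basic (φ ⊤) = _
    rw [StoneSpace.basic_top, hφ, TopHomClass.map_top]; rfl
  · apply StoneSpace.basic_injective
    change StoneSpace.basic (φ ⊥) = _
    rw [StoneSpace.basic_bot, hφ, BotHomClass.map_bot]; rfl
  · apply StoneSpace.basic_injective
    change StoneSpace.basic (φ (g n)) = _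
    rw [hφ, hι]
    ext V
    simp [SetAlgebra.cylinder, p, StoneSpace.mem_basic]
  · refine hom_eq_of_closure_eq_top hg fun n => (hψ n).trans ?_
    apply StoneSpace.basic_injective
    change _ = StoneSpace.basic (φ (g n))
    rw [hφ, hι]
    ext V
    simp [SetAlgebra.cylinder, p, StoneSpace.mem_basic]

end Free

end BooleanAlg

/-! ### Non-atomic measures and the properties of the final algebra. -/

namespace SetAlgebra

open MeasureTheory BooleanAlg

section

variable {X : Type*} {𝒲 : BooleanSubalgebra (Set X)}

open Classical in
/-- The extension by zero of a function on an algebra of sets. -/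
noncomputable def extend (𝒲 : BooleanSubalgebra (Set X)) (φ : 𝒲 → ℝ) (s : Set X) : ℝ :=
  if h : s ∈ 𝒲 then φ ⟨s, h⟩ else 0

theorem extend_of_mem (φ : 𝒲 → ℝ) {s : Set X} (h : s ∈ 𝒲) : extend 𝒲 φ s = φ ⟨s, h⟩ := dif_pos h

theorem isFinAdd_extend {φ : 𝒲 → ℝ} (hadd : ∀ a b, Disjoint a b → φ (a ⊔ b) = φ a + φ b)
    (hbdd : ∃ B, ∀ a, |φ a| ≤ B) : IsFinAdd 𝒲 (extend 𝒲 φ) := by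
  refine ⟨fun a ha b hb hab => ?_, hbdd.imp fun B hB a ha => by
    rw [extend_of_mem φ ha]; exact hB _⟩
  rw [extend_of_mem φ ha, extend_of_mem φ hb, extend_of_mem φ (union_mem ha hb), ← hadd]
  · rfl
  · rw [disjoint_iff]
    exact Subtype.ext (disjoint_iff.1 hab)

theorem IsNikodym.hasNikodymProperty (h : IsNikodym 𝒲) : HasNikodymProperty 𝒲 := by
  intro μ hμ
  by_contra hcon
  have hbd : ∀ n, ∃ B, ∀ a, |(μ n).toFun a| ≤ B := fun n => by
    obtain ⟨B, hB⟩ := (μ n).bounded'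
    exact ⟨B, fun a => (le_add_of_nonneg_right (abs_nonneg _)).trans
      (hB ⟨a, ⊥, disjoint_bot_right, rfl⟩)⟩
  refine h (fun n => extend 𝒲 (μ n).toFun) ⟨fun n => isFinAdd_extend (μ n).map_sup' (hbd n),
    fun a ha => ?_, fun C => ?_⟩
  · obtain ⟨C, hC⟩ := hμ ⟨a, ha⟩
    exact ⟨C, fun n => by rw [extend_of_mem _ ha]; exact hC ⟨n, rfl⟩⟩
  · by_contra! hC
    refine hcon ⟨C + C, ?_⟩
    have hC' : ∀ n a, |(μ n).toFun a| ≤ C := fun n a => by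
      have := hC n a a.2
      rwa [extend_of_mem _ a.2] at this
    rintro _ ⟨n, rfl⟩
    refine csSup_le ⟨_, ⊥, ⊥, disjoint_bot_right, rfl⟩ ?_
    rintro _ ⟨a, b, -, rfl⟩
    exact add_le_add (hC' n a) (hC' n b)

/-- The ultrafilter of all members of `𝒲` containing a point. -/
def pointUltrafilter (𝒲 : BooleanSubalgebra (Set X)) (z : X) : StoneSpace 𝒲 :=
  ⟨{a | z ∈ a.1}, Set.mem_univ z, fun h => h, fun _ _ ha hb => ⟨ha, hb⟩, fun _ _ ha hab => hab ha,
    fun a => Classical.em (z ∈ a.1)⟩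

/-- If points are null, the algebra has finite covers by sets of small measure. -/
theorem exists_finite_cover_of_isNonAtomic {μ : Measure (StoneSpace 𝒲)} [IsFiniteMeasure μ]
    [μ.Regular] (hμ : IsNonAtomic μ) {ε : ℝ} (hε : 0 < ε) :
    ∃ P : Set (Set X), P.Finite ∧ P ⊆ 𝒲 ∧ ⋃₀ P = Set.univ ∧
      ∀ p ∈ P, extend 𝒲 (fun a => μ.real (StoneSpace.basic a)) p ≤ ε := by
  have hpt : ∀ V : StoneSpace 𝒲, ∃ a : 𝒲, a ∈ V.1 ∧ μ.real (StoneSpace.basic a) ≤ ε := by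
    intro V
    -- A point of positive measure would be an atom: its only subsets are itself and the empty set.
    have h0 : μ {V} = 0 := by
      by_contra hne
      obtain ⟨C, -, hCV, hC0, hlt⟩ := hμ {V} (StoneSpace.isClosed_singleton V).measurableSet
        (pos_iff_ne_zero.2 hne)
      rcases Set.subset_singleton_iff_eq.1 hCV with rfl | rfl
      · simp at hC0
      · exact lt_irrefl _ hlt
    obtain ⟨O, hVO, hO, hlt⟩ := Set.exists_isOpen_lt_of_lt {V} (ENNReal.ofReal ε)
      (by rw [h0]; simpa using hε)
    obtain ⟨_, ⟨a, rfl⟩, hVa, haO⟩ :=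
      StoneSpace.isTopologicalBasis_basic.exists_subset_of_mem_open (hVO rfl) hO
    exact ⟨a, hVa, ENNReal.toReal_le_of_le_ofReal hε.le ((measure_mono haO).trans hlt.le)⟩
  choose a ha hle using hpt
  obtain ⟨t, ht⟩ := isCompact_univ.elim_finite_subcover (fun V => StoneSpace.basic (a V))
    (fun V => StoneSpace.isOpen_basic _) (fun V _ => Set.mem_iUnion.2 ⟨V, ha V⟩)
  refine ⟨(fun V => (a V).1) '' (t : Set (StoneSpace 𝒲)), t.finite_toSet.image _, ?_, ?_, ?_⟩
  · rintro _ ⟨V, -, rfl⟩; exact (a V).2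
  · refine Set.eq_univ_of_forall fun z => ?_
    obtain ⟨V, hV, hz⟩ := Set.mem_iUnion₂.1 (ht (Set.mem_univ (pointUltrafilter 𝒲 z)))
    exact ⟨_, ⟨V, hV, rfl⟩, hz⟩
  · rintro _ ⟨V, -, rfl⟩
    rw [extend_of_mem _ (a V).2]
    exact hle V

theorem isFinAdd_extend_measure (μ : Measure (StoneSpace 𝒲)) [IsFiniteMeasure μ] :
    IsFinAdd 𝒲 (extend 𝒲 fun a => μ.real (StoneSpace.basic a)) := by
  refine isFinAdd_extend (fun a b hab => ?_) ⟨μ.real Set.univ, fun a => ?_⟩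
  · rw [StoneSpace.basic_sup, measureReal_union ?_ (StoneSpace.isOpen_basic b).measurableSet]
    rw [Set.disjoint_iff_inter_eq_empty, ← StoneSpace.basic_inf, disjoint_iff.1 hab,
      StoneSpace.basic_bot]
  · rw [abs_of_nonneg measureReal_nonneg]
    exact measureReal_mono (Set.subset_univ _)

/-- A measure approximable from below by a countable subfamily of the algebra is uniformly
regular. -/
theorem isUniformlyRegular_of_countable {μ : Measure (StoneSpace 𝒲)} [IsFiniteMeasure μ]
    [μ.Regular] {T : Set (Set X)} (hT : T.Countable) (hTW : T ⊆ 𝒲)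
    (h : ∀ a ∈ 𝒲, ∀ ε > 0, ∃ c ∈ T, c ⊆ a ∧
      extend 𝒲 (fun a => μ.real (StoneSpace.basic a)) (a \ c) ≤ ε) : IsUniformlyRegular μ := by
  refine ⟨StoneSpace.basic '' {a : 𝒲 | a.1 ∈ T}, (hT.preimage Subtype.val_injective).image _,
    ?_, fun U hU ε hε => ?_⟩
  · rintro _ ⟨a, -, rfl⟩
    exact (StoneSpace.isClopen_basic a).isZeroSet
  obtain ⟨δ, hδ0, hδ⟩ := ENNReal.lt_iff_exists_nnreal_btwn.1 hε
  have hδ2 : 0 < (δ : ℝ) / 2 := half_pos (by exact_mod_cast hδ0)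
  -- Half of the error goes to inner regularity, with a clopen set fitted between a compact set and
  -- `U`; the other half goes to the countable family.
  obtain ⟨a, haU, ha⟩ : ∃ a : 𝒲, StoneSpace.basic a ⊆ U ∧
      μ (U \ StoneSpace.basic a) ≤ ENNReal.ofReal (δ / 2) := by
    by_cases hU0 : μ U = 0
    · exact ⟨⊥, by simp [StoneSpace.basic_bot], by simp [StoneSpace.basic_bot, hU0]⟩
    obtain ⟨C, hCU, hC, hlt⟩ := hU.exists_lt_isCompact (μ := μ)
      (ENNReal.sub_lt_self (measure_ne_top μ U) hU0 (ENNReal.ofReal_pos.2 hδ2).ne')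
    obtain ⟨a, hCa, haU⟩ := StoneSpace.exists_basic_between hC hU hCU
    refine ⟨a, haU, ?_⟩
    rw [measure_sdiff haU (StoneSpace.isOpen_basic a).measurableSet.nullMeasurableSet
      (measure_ne_top _ _)]
    have h1 := tsub_le_iff_right.1 (hlt.le.trans (measure_mono hCa))
    exact tsub_le_iff_left.2 h1
  obtain ⟨c, hcT, hca, hc⟩ := h a a.2 (δ / 2) hδ2
  refine ⟨_, ⟨⟨c, hTW hcT⟩, hcT, rfl⟩, ?_, lt_of_le_of_lt ?_ hδ⟩
  · exact (StoneSpace.basic_mono (a := (⟨c, hTW hcT⟩ : 𝒲)) (b := a) hca).trans haU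
  · have hac : μ (StoneSpace.basic a \ StoneSpace.basic (⟨c, hTW hcT⟩ : 𝒲)) ≤
        ENNReal.ofReal (δ / 2) := by
      rw [extend_of_mem _ (diff_mem a.2 (hTW hcT))] at hc
      rw [← StoneSpace.basic_sdiff, ← ofReal_measureReal]
      exact ENNReal.ofReal_le_ofReal hc
    calc μ (U \ StoneSpace.basic (⟨c, hTW hcT⟩ : 𝒲))
        ≤ μ ((U \ StoneSpace.basic a) ∪
            (StoneSpace.basic a \ StoneSpace.basic (⟨c, hTW hcT⟩ : 𝒲))) :=
          measure_mono fun z hz => by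
            by_cases hza : z ∈ StoneSpace.basic a
            exacts [Or.inr ⟨hza, hz.2⟩, Or.inl ⟨hz.1, hza⟩]
      _ ≤ ENNReal.ofReal (δ / 2) + ENNReal.ofReal (δ / 2) :=
          (measure_union_le _ _).trans (add_le_add ha hac)
      _ = δ := by
          rw [← ENNReal.ofReal_add hδ2.le hδ2.le, add_halves, ENNReal.ofReal_coe_nnreal]

end

variable {x : CountableOrdinal → Set (ℕ → Bool)}

/-- Along a chain of minimal extensions, a stage with covers by sets of arbitrarily small measure
is dense from below in all later stages. -/
theorem exists_stage_subset (hx : ∀ i : CountableOrdinal, Admissible (stage x i) (x i))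
    {ν : Set (ℕ → Bool) → ℝ} (hν : IsFinAdd (stage x ω₁) ν) (hν0 : ∀ a ∈ stage x ω₁, 0 ≤ ν a)
    {α : Ordinal.{0}}
    (hα : ∀ ε > 0, ∃ P : Set (Set (ℕ → Bool)), P.Finite ∧ P ⊆ stage x α ∧ ⋃₀ P = Set.univ ∧
      ∀ p ∈ P, ν p ≤ ε) (β : Ordinal.{0}) (hαβ : α ≤ β) (hβ : β ≤ ω₁) :
    ∀ a ∈ stage x β, ∀ ε > 0, ∃ c ∈ stage x α, c ⊆ a ∧ ν (a \ c) ≤ ε := by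
  induction β using WellFoundedLT.induction with
  | ind β ih =>
  intro a ha ε hε
  rcases hαβ.eq_or_lt with rfl | hlt
  · exact ⟨a, ha, subset_rfl, by rw [Set.sdiff_self]; exact hν.empty.trans_le hε.le⟩
  rcases Ordinal.zero_or_succ_or_isSuccLimit β with rfl | ⟨γ, rfl⟩ | hlim
  · exact absurd hlt (not_lt_bot (a := α))
  · have hγ : γ < ω₁ := (Order.lt_succ γ).trans_le hβ
    have hαγ : α ≤ γ := Order.lt_succ_iff.1 hlt
    rw [stage_succ ⟨γ, hγ⟩] at ha
    rcases hx ⟨γ, hγ⟩ with hmem | ⟨U, hU, hxU⟩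
    · rw [adjoin_eq_self hmem] at ha
      exact ih γ (Order.lt_succ γ) hαγ hγ.le a ha ε hε
    have hle : stage x γ ≤ stage x ω₁ := stage_mono hγ.le
    have haW : a ∈ stage x ω₁ := by
      rw [← stage_succ ⟨γ, hγ⟩] at ha
      exact stage_mono hβ ha
    -- The split ultrafilter contains a piece of measure at most ε/2, so `a` may be replaced by `a \
    -- U j`, which already lies in stage `γ`.
    obtain ⟨P, hPfin, hPA, hPcov, hPν⟩ := hα (ε / 2) (half_pos hε)
    obtain ⟨p, hp, j, hj⟩ := hU.exists_subset_of_cover hPfin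
      (hPA.trans (stage_mono hαγ)) hPcov
    have hpW : p ∈ stage x ω₁ := stage_mono (hαγ.trans hγ.le) (hPA hp)
    have haU : a \ U j ∈ stage x γ := diff_mem_of_mem_adjoin hU.mem hxU ha j
    obtain ⟨c, hc, hca, hcν⟩ := ih γ (Order.lt_succ γ) hαγ hγ.le _ haU _ (half_pos hε)
    have hcW : c ∈ stage x ω₁ := stage_mono (hαγ.trans hγ.le) hc
    have hUW := hle (hU.mem j)
    refine ⟨c, hc, hca.trans Set.sdiff_subset, ?_⟩
    have h1 := hν.inter_add_diff (diff_mem haW hcW) hUW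
    have h2 : ν ((a \ c) ∩ U j) ≤ ν p := hν.mono_of_nonneg hν0
      (inter_mem (diff_mem haW hcW) hUW) hpW (Set.inter_subset_right.trans hj)
    have h3 : (a \ c) \ U j = (a \ U j) \ c := by
      rw [Set.sdiff_sdiff, Set.sdiff_sdiff, Set.union_comm]
    rw [h3] at h1
    have h4 := hPν p hp
    linarith
  · obtain ⟨γ, hγ, haγ⟩ := exists_lt_mem_stage hlim ha
    exact ih (max α γ) (max_lt hlt hγ) (le_max_left _ _) ((max_lt hlt hγ).le.trans hβ) a
      (stage_mono (le_max_right _ _) haγ) ε hε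

theorem isUniformlyRegular_of_isNonAtomic
    (hx : ∀ i : CountableOrdinal, Admissible (stage x i) (x i))
    {μ : Measure (StoneSpace (stage x ω₁))} [IsFiniteMeasure μ] [μ.Regular] (hμ : IsNonAtomic μ) :
    IsUniformlyRegular μ := by
  choose P hPfin hPA hPcov hPμ using fun N : ℕ =>
    exists_finite_cover_of_isNonAtomic hμ (Nat.one_div_pos_of_nat (α := ℝ) (n := N))
  obtain ⟨α, hα, hαP⟩ := exists_stage_of_countable (y := x) (T := ⋃ N, P N)
    (Set.countable_iUnion fun N => (hPfin N).countable) (Set.iUnion_subset hPA)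
  refine isUniformlyRegular_of_countable (countable_stage hα) (stage_mono hα.le)
    (exists_stage_subset hx (isFinAdd_extend_measure μ) (fun a ha => ?_) (fun ε hε => ?_) ω₁ hα.le
      le_rfl)
  · rw [extend_of_mem _ ha]; exact measureReal_nonneg
  · obtain ⟨N, hN⟩ := exists_nat_one_div_lt hε
    exact ⟨P N, hPfin N, (Set.subset_iUnion P N).trans hαP, hPcov N,
      fun p hp => (hPμ N p hp).trans hN.le⟩

theorem isFreeOnCountable_stage_zero :
    IsFreeOnCountable ((stage x 0).comap (stage x ω₁).subtype) := by
  let g : ℕ → (stage x 0).comap (stage x ω₁).subtype := fun n =>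
    ⟨⟨cylinder n, cylinder_mem_stage n _⟩, cylinder_mem_stage n _⟩
  refine isFreeOnCountable_of_cylinder ((stage x ω₁).subtype.comp (BooleanSubalgebra.subtype _))
    (g := g) ?_ fun n => rfl
  -- The membership proofs are quantified after the induction variable so that closure induction can
  -- run on the underlying set.
  have key : ∀ (s : Set (ℕ → Bool)) (hs : s ∈ BooleanSubalgebra.closure (Set.range cylinder)),
      ∀ (h : s ∈ stage x ω₁) (h' : s ∈ stage x 0),
        (⟨⟨s, h⟩, h'⟩ : (stage x 0).comap (stage x ω₁).subtype) ∈
          BooleanSubalgebra.closure (Set.range g) := by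
    intro s hs
    induction hs using BooleanSubalgebra.closure_bot_sup_induction with
    | mem s hs =>
      obtain ⟨n, rfl⟩ := hs
      exact fun _ _ => BooleanSubalgebra.subset_closure ⟨n, rfl⟩
    | bot => exact fun _ _ => BooleanSubalgebra.bot_mem
    | sup s hs t ht ihs iht =>
      intro _ _
      rw [← stage_zero (y := x)] at hs ht
      exact BooleanSubalgebra.sup_mem (ihs (stage_mono bot_le hs) hs)
        (iht (stage_mono bot_le ht) ht)
    | compl s hs ih =>
      intro _ _
      rw [← stage_zero (y := x)] at hs
      exact BooleanSubalgebra.compl_mem (ih (stage_mono bot_le hs) hs)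
  refine eq_top_iff.2 fun b _ => key b.1.1 ?_ b.1.2 b.2
  rw [← stage_zero (y := x)]
  exact b.2

theorem isMinimallyGenerated_stage (hx : ∀ i : CountableOrdinal, Admissible (stage x i) (x i)) :
    IsMinimallyGenerated (stage x ω₁) := by
  refine ⟨ω₁, fun α => (stage x α).comap (stage x ω₁).subtype,
    fun α _ β _ h => BooleanSubalgebra.comap_mono (stage_mono h), eq_top_iff.2 fun a _ => a.2,
    isFreeOnCountable_stage_zero, fun γ _ hγ => ?_, fun α hα => ?_⟩
  · refine Set.Subset.antisymm (fun a ha => ?_) (Set.iUnion₂_subset fun α hα =>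
      BooleanSubalgebra.comap_mono (stage_mono (le_of_lt hα)))
    obtain ⟨α, hα, haα⟩ := exists_lt_mem_stage hγ ha
    exact Set.mem_iUnion₂.2 ⟨α, hα, haα⟩
  · have h := (hx ⟨α, hα⟩).isMinimalExtension
    rw [← stage_succ ⟨α, hα⟩] at h
    exact h.comap_subtype (stage_mono (Order.succ_le_of_lt hα))

theorem infinite_stage (α : Ordinal.{0}) : Infinite (stage x α) := by
  refine Infinite.of_injective (fun n : ℕ => (⟨cylinder n, cylinder_mem_stage n α⟩ : stage x α)) ?_
  intro n k h
  have h1 : cylinder n = cylinder k := congrArg Subtype.val h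
  have h2 : (fun i => decide (i = n)) ∈ cylinder n := by simp [cylinder]
  rw [h1] at h2
  exact Eq.symm (by simpa [cylinder] using h2)

end SetAlgebra

theorem corollary4p3 (diamond : DiamondPrinciple) :
    ∃ (A : Type) (_ : BooleanAlgebra A),
      Infinite A ∧
      BooleanAlg.IsMinimallyGenerated A ∧
      BooleanAlg.HasNikodymProperty A ∧
      (∀ μ : MeasureTheory.Measure (BooleanAlg.StoneSpace A),
        MeasureTheory.IsProbabilityMeasure μ → μ.Regular → BooleanAlg.IsNonAtomic μ →
          BooleanAlg.IsUniformlyRegular μ) ∧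
      (∀ μ : MeasureTheory.Measure (BooleanAlg.StoneSpace A),
        MeasureTheory.IsProbabilityMeasure μ → μ.Regular → BooleanAlg.IsNonAtomic μ →
          ∃ x : ℕ → BooleanAlg.StoneSpace A, BooleanAlg.IsUniformlyDistributed μ x) := by
  obtain ⟨G, hG⟩ := diamond.exists_guess
  obtain ⟨x, hx⟩ := SetAlgebra.exists_generators G
  have hadm := fun i => (hx i).1
  exact ⟨SetAlgebra.stage x ω₁, inferInstance, SetAlgebra.infinite_stage _,
    SetAlgebra.isMinimallyGenerated_stage hadm,
    (SetAlgebra.isNikodym_of_generators hG fun i => (hx i).2).hasNikodymProperty,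
    fun μ _ _ hμ => SetAlgebra.isUniformlyRegular_of_isNonAtomic hadm hμ,
    fun μ _ _ hμ =>
      (SetAlgebra.isUniformlyRegular_of_isNonAtomic hadm hμ).exists_isUniformlyDistributed⟩
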